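/- For $Q\in\mathbb N$ let $\mathcal F(Q)=\{p/q:\ 0\le p\le q\le Q,\ q\ge 1,\ \gcd(p,q)=1\}$ be the set of Farey fractions of order $Q$. For $I=[\alpha,\beta]$ with $0\le\alpha<\beta\le1$ and $\delta>0$ put $Q=\lfloor(2\delta)^{-1/2}\rfloor$ and write $\mathcal F(Q)\cap I=\{p_1/q_1<\dots<p_N/q_N\}$, in lowest terms, $N=N_I(Q)$. The limiting distribution of a function $F$ on $\Omega=\{(x,y)\in(0,1]^2: x+y>1\}$ is $$G_F(t)=\lim_{\delta\to0^+}\frac{\#\{1\le j\le N_I(Q)-1:\ F(q_j/Q,\,q_{j+1}/Q)\ge t\}}{N_I(Q)}\qquad(t\in\mathbb R).$$ Write $f\sim g$ if $f(t)/g(t)\to1$ as $t\to\infty$, and $f\asymp g$ if there are $c_1,c_2>0$ and $t_0$ with $c_1|g(t)|\le|f(t)|\le c_2|g(t)|$ for all $t>t_0$. **Theorem.** For each of the following five functions $F$, the limit $G_F(t)$ exists for every $t\in\mathbb R$ and every such $I$, does not depend on $I$, and has the stated behaviour as $t\to\infty$: 1. (Euclidean distance) for $F(x,y)=\frac1{2x^2}+\frac1{2y^2}$: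 $\;G_F(t)\sim\frac1t$. 2. (Hyperbolic distance) for $F(x,y)=\frac12\left(\frac yx+\frac xy\right)$: $\;G_F(t)=\dfrac{2}{(t+\sqrt{t^2-1})(t+\sqrt{t^2-1}+1)}$ for all $t\ge1$, and so $G_F(t)\sim\frac1{2t^2}$. 3. (Euclidean slope) for $F(x,y)=\frac12\left(\frac xy-\frac yx\right)$: $\;G_F(t)\asymp\frac1{t^2}$. 4. (Euclidean area) for $F(x,y)=\frac14\left(\frac1{x^3y}+\frac1{xy^3}\right)$: $\;G_F(t)\asymp\frac1{t^{2/3}}$. 5. (Hyperbolic angle) for $F(x,y)=\frac{4x^5}{y^3}-4xy+\frac{16x^3}{y}$: $\;G_F(t)\asymp\frac1{t^{2/3}}$. -/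

import Mathlib

open Filter Topology Asymptotics

namespace FareyFord

/-- The Farey fractions of order `Q` (rationals `p / q` in lowest terms with `0 ≤ p ≤ q ≤ Q`)
lying in the interval `[α, β]`; these are the tangency points of the Ford circles considered. -/
def fareyPoints (α β : ℝ) (Q : ℕ) : Set ℚ :=
  {r | 0 ≤ r ∧ r ≤ 1 ∧ r.den ≤ Q ∧ (r : ℝ) ∈ Set.Icc α β}

/-- There are only finitely many such fractions, so that cardinalities below are genuine. -/
theorem fareyPoints_finite (α β : ℝ) (Q : ℕ) : (fareyPoints α β Q).Finite := by
  refine ((Set.finite_Icc (0 : ℤ) Q).prod (Set.finite_Icc (0 : ℕ) Q)).of_injOn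
    (f := fun r : ℚ => (r.num, r.den)) ?_ ?_
  · rintro r ⟨h0, h1, hQ, -⟩
    have hn : r.num ≤ r.den := Rat.num_le_denom_iff.mpr h1
    have hd : (r.den : ℤ) ≤ Q := by exact_mod_cast hQ
    exact ⟨⟨Rat.num_nonneg.mpr h0, hn.trans hd⟩, Nat.zero_le _, hQ⟩
  · intro r _ s _ h
    simp only [Prod.mk.injEq] at h
    exact Rat.ext h.1 h.2

/-- The pairs `(p_j / q_j, p_{j+1} / q_{j+1})`, `1 ≤ j ≤ N - 1`, of consecutive elements of the
increasing enumeration `p_1 / q_1 < ⋯ < p_N / q_N` of `fareyPoints α β Q`. -/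
def consecutivePairs (α β : ℝ) (Q : ℕ) : Set (ℚ × ℚ) :=
  {z | z.1 ∈ fareyPoints α β Q ∧ z.2 ∈ fareyPoints α β Q ∧ z.1 < z.2 ∧
    ∀ u ∈ fareyPoints α β Q, ¬ (z.1 < u ∧ u < z.2)}

/-- The order `Q = ⌊(2δ)^(-1/2)⌋` belonging to the height `δ`. -/
noncomputable def order (δ : ℝ) : ℕ := ⌊(2 * δ) ^ (-(1 / 2) : ℝ)⌋₊

/-- The number of indices `j` with `F (q_j / Q) (q_{j+1} / Q) ≥ t`, divided by the number
`N` of Farey fractions in `[α, β]` of order `Q = ⌊(2δ)^(-1/2)⌋`. -/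
noncomputable def proportion (F : ℝ → ℝ → ℝ) (α β δ t : ℝ) : ℝ :=
  ({z ∈ consecutivePairs α β (order δ) |
      t ≤ F (z.1.den / order δ) (z.2.den / order δ)}.ncard : ℝ) /
    ((fareyPoints α β (order δ)).ncard : ℝ)

/-- `G` is the limiting distribution of the statistic `F`: for every nondegenerate interval
`[α, β] ⊆ [0, 1]` and every real `t`, the limit as `δ → 0+` of the proportion of circles at which
`F` is at least `t` exists and equals `G t`. -/
def IsLimitingDistribution (F : ℝ → ℝ → ℝ) (G : ℝ → ℝ) : Prop :=
  ∀ α β : ℝ, 0 ≤ α → α < β → β ≤ 1 → ∀ t : ℝ,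
    Tendsto (fun δ : ℝ => proportion F α β δ t) (𝓝[>] 0) (𝓝 (G t))

end FareyFord

namespace FareyFord

/-! Two consecutive Farey fractions r < s of order Q have determinant 1, and their denominators (q,
n) range over the coprime pairs with q, n ≤ Q < q + n. Such a pair determines r, whose numerator is
-n⁻¹ mod q. Up to one boundary pair, the quantity to count is therefore the number of coprime points
in the Q-dilate of {F ≥ t} ∩ Ω for which the fraction with numerator -n⁻¹ mod q and denominator q
lies in [α, β].

The heart of the matter is a joint equidistribution: this number is (6/π²) · area · (β - α) · Q² +
o(Q²). Dividing by the same count for all of Ω, whose area is 1/2, cancels 6/π² and β - α, so G_F(t)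
is twice the area of {F ≥ t} ∩ Ω and does not depend on the interval
(`isLimitingDistribution_tailArea`).

The area factor comes from counting lattice points in dilates together with Möbius inversion
(`IsStarRegion.tendsto_card_coprimePairs`). The factor β - α comes from Weyl's criterion: for fixed
q, n runs over an interval of at most q integers, so the Weyl sums are incomplete Kloosterman sums.
Any fixed power saving suffices, so Weil's bound is not needed: Kloosterman's fourth moment gives
exponent 4/5 up to the divisor function (`norm_kloosterman_le_rpow`), completion costs a logarithm,
and the divisor function is harmless on average over q (`tendsto_sum_fourier_leftFraction`).

For the tails, {F ≥ t} retreats into the corners of Ω near (0, 1) and (1, 0) as t grows. A corner of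
width c is a right triangle of area c²/2, so the width at which F reaches t gives the rate. For the
hyperbolic distance {F ≥ t} is a union of two cones, and the area is computed exactly. -/

/-! ### Kloosterman sums: a power saving from the fourth moment -/

open Finset in
/-- The exponential sum attached to a finite family of points of `(ℤ/q)²` has second moment equal
to `q²` times the number of coincidences. -/
theorem sum_norm_sq_expSum {q : ℕ} [NeZero q] {ι : Type*} [Fintype ι] (f g : ι → ZMod q) :
    ∑ h : ZMod q, ∑ k : ZMod q,
      ‖∑ i, ZMod.stdAddChar (h * f i + k * g i)‖ ^ 2 =
    (q : ℝ) ^ 2 * (Finset.univ.filter fun z : ι × ι => f z.1 = f z.2 ∧ g z.1 = g z.2).card := by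
  have horth : ∀ a : ZMod q, ∑ h : ZMod q, ZMod.stdAddChar (h * a) = if a = 0 then (q : ℂ) else 0 := by
    intro a
    have := AddChar.sum_mulShift a (ZMod.isPrimitive_stdAddChar q)
    simpa [ZMod.card] using this
  have hsq : ∀ z : ℂ, ((‖z‖ ^ 2 : ℝ) : ℂ) = z * (starRingEnd ℂ) z := fun z => by
    rw [Complex.mul_conj, Complex.normSq_eq_norm_sq]
  apply Complex.ofReal_injective
  push_cast
  have key : ∀ h k : ZMod q, ((‖∑ i, ZMod.stdAddChar (h * f i + k * g i)‖ : ℂ)) ^ 2 =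
      ∑ z : ι × ι, ZMod.stdAddChar (h * (f z.1 - f z.2)) * ZMod.stdAddChar (k * (g z.1 - g z.2)) := by
    intro h k
    have := hsq (∑ i, ZMod.stdAddChar (h * f i + k * g i))
    push_cast at this
    rw [this, map_sum, Finset.sum_mul_sum, ← Finset.univ_product_univ, Finset.sum_product]
    refine Finset.sum_congr rfl fun i _ => Finset.sum_congr rfl fun j _ => ?_
    rw [← AddChar.map_neg_eq_conj, ← AddChar.map_add_eq_mul, ← AddChar.map_add_eq_mul]
    congr 1; ring
  simp_rw [key]
  calc _ = ∑ z : ι × ι, (∑ h : ZMod q, ZMod.stdAddChar (h * (f z.1 - f z.2))) *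
        (∑ k : ZMod q, ZMod.stdAddChar (k * (g z.1 - g z.2))) := by
        simp_rw [Finset.sum_mul_sum]
        rw [Finset.sum_comm' (t' := Finset.univ) (s' := fun _ => Finset.univ) (by simp)]
        rw [Finset.sum_comm]
        simp_rw [Finset.sum_comm (s := (Finset.univ : Finset (ι × ι)))]
    _ = ∑ z : ι × ι, if f z.1 = f z.2 ∧ g z.1 = g z.2 then (q : ℂ) ^ 2 else 0 := by
        refine Finset.sum_congr rfl fun z _ => ?_
        rw [horth, horth]
        simp only [sub_eq_zero]
        split_ifs <;> simp_all [sq]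
    _ = _ := by
        rw [← Finset.sum_filter, Finset.sum_const, nsmul_eq_mul, mul_comm]

/-- The Kloosterman sum `∑ e((h x + k x⁻¹) / q)` over the units modulo `q`. -/
noncomputable def kloosterman {q : ℕ} [NeZero q] (h k : ZMod q) : ℂ :=
  ∑ x : (ZMod q)ˣ, ZMod.stdAddChar (h * (x : ZMod q) + k * ((x⁻¹ : (ZMod q)ˣ) : ZMod q))

theorem norm_kloosterman_le {q : ℕ} [NeZero q] (h k : ZMod q) :
    ‖kloosterman h k‖ ≤ q.totient := by
  refine (norm_sum_le _ _).trans ?_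
  simp [AddChar.norm_apply, ZMod.card_units_eq_totient]

/-- Substitute u * x for x. The sum is thus constant along the orbit (hu, ku⁻¹), which lets an
average over all frequencies control a single sum. -/
theorem kloosterman_smul {q : ℕ} [NeZero q] (h k : ZMod q) (u : (ZMod q)ˣ) :
    kloosterman (h * (u : ZMod q)) (k * ((u⁻¹ : (ZMod q)ˣ) : ZMod q)) = kloosterman h k := by
  unfold kloosterman
  refine Fintype.sum_equiv (Equiv.mulLeft u) _ _ fun x => ?_
  simp [mul_assoc, mul_comm, mul_left_comm]

/-- A set of residues modulo `q` whose differences are killed by `d` has at most `d` elements. -/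
theorem card_nsmul_eq_le {q : ℕ} [NeZero q] {d : ℕ} (hd : 0 < d) (s : Finset (ZMod q))
    (hs : ∀ x ∈ s, ∀ y ∈ s, d • (x - y) = 0) : s.card ≤ d := by
  rcases s.eq_empty_or_nonempty with rfl | ⟨y, hy⟩
  · simp
  refine le_trans ?_ (IsAddCyclic.card_nsmul_eq_zero_le (α := ZMod q) hd)
  refine Finset.card_le_card_of_injOn (fun x => x - y) ?_ ?_
  · intro x hx
    simp only [Finset.coe_filter, Finset.mem_univ, true_and, Set.mem_ofPred_eq]
    exact hs x hx y hy
  · intro a _ b _ h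
    exact sub_left_injective h

/-- By Bézout the gcd is a multiple of `a` modulo q, so it kills whatever `a` kills. -/
theorem gcd_nsmul_eq_zero {q : ℕ} [NeZero q] {a y : ZMod q} (h : a * y = 0) :
    (Nat.gcd a.val q) • y = 0 := by
  have hb := Nat.gcd_eq_gcd_ab a.val q
  have : ((Nat.gcd a.val q : ℕ) : ZMod q) = a * (Nat.gcdA a.val q : ℤ) := by
    have := congrArg (Int.cast : ℤ → ZMod q) hb
    push_cast at this
    simpa using this
  rw [nsmul_eq_mul, this, mul_right_comm, h, zero_mul]

/-- Each gcd is at most the sum of the common divisors of a and q; a divisor d of q divides at most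
q / d residues, so it contributes at most q. -/
theorem sum_gcd_le (q : ℕ) [NeZero q] :
    ∑ a : ZMod q, Nat.gcd a.val q ≤ q * q.divisors.card := by
  have hq : 0 < q := Nat.pos_of_ne_zero (NeZero.ne q)
  calc ∑ a : ZMod q, Nat.gcd a.val q ≤ ∑ a : ZMod q, ∑ d ∈ q.divisors, if d ∣ a.val then d else 0 := by
        refine Finset.sum_le_sum fun a _ => ?_
        have hm : Nat.gcd a.val q ∈ q.divisors := by simp [Nat.gcd_dvd_right, hq.ne']
        refine le_trans ?_ (Finset.single_le_sum (f := fun d => if d ∣ a.val then d else 0)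
          (fun _ _ => Nat.zero_le _) hm)
        simp [Nat.gcd_dvd_left]
    _ = ∑ d ∈ q.divisors, (Finset.univ.filter fun a : ZMod q => d ∣ a.val).card * d := by
        rw [Finset.sum_comm]
        refine Finset.sum_congr rfl fun d _ => ?_
        rw [← Finset.sum_filter, Finset.sum_const, smul_eq_mul]
    _ ≤ ∑ d ∈ q.divisors, q := by
        refine Finset.sum_le_sum fun d hd => ?_
        obtain ⟨e, he⟩ := (Nat.mem_divisors.1 hd).1
        have : (Finset.univ.filter fun a : ZMod q => d ∣ a.val).card ≤ (Finset.range e).card := by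
          refine Finset.card_le_card_of_injOn (fun a => a.val / d) ?_ ?_
          · intro a _
            have := ZMod.val_lt a
            rw [Finset.coe_range, Set.mem_Iio]
            exact Nat.div_lt_of_lt_mul (by rw [← he]; exact this)
          · intro a ha b hb hab
            simp only [Finset.coe_filter, Finset.mem_univ, true_and, Set.mem_ofPred_eq] at ha hb
            exact ZMod.val_injective q (Nat.div_left_inj ha hb |>.1 hab)
        rw [Finset.card_range] at this
        calc _ ≤ e * d := Nat.mul_le_mul_right _ this
          _ = q := by rw [he, mul_comm]
    _ = _ := by rw [Finset.sum_const, smul_eq_mul, mul_comm]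

/-- The count behind the fourth moment. Put a = x + y and b = z - x. Clearing inverses and
eliminating y and w leaves ab(a - b - 2x) = 0. For fixed a, b the differences of solutions x are
killed by 2 gcd(a, q) gcd(b, q), which therefore bounds their number, and the sum over a, b factors.
-/
theorem card_add_eq_add_inv_le (q : ℕ) [NeZero q] :
    (Finset.univ.filter fun z : ((ZMod q)ˣ × (ZMod q)ˣ) × ((ZMod q)ˣ × (ZMod q)ˣ) =>
      (z.1.1 : ZMod q) + z.1.2 = z.2.1 + z.2.2 ∧
      ((z.1.1⁻¹ : (ZMod q)ˣ) : ZMod q) + ((z.1.2⁻¹ : (ZMod q)ˣ) : ZMod q) =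
        ((z.2.1⁻¹ : (ZMod q)ˣ) : ZMod q) + ((z.2.2⁻¹ : (ZMod q)ˣ) : ZMod q)).card ≤
    2 * (q * q.divisors.card) ^ 2 := by
  classical
  set g : ZMod q → ℕ := fun a => Nat.gcd a.val q with hg
  have hgpos : ∀ a, 0 < g a := fun a => Nat.gcd_pos_of_pos_right _ (Nat.pos_of_ne_zero (NeZero.ne q))
  let T : ZMod q → ZMod q → Finset (ZMod q) := fun a b =>
    Finset.univ.filter fun x => a * b * (a - b - 2 * x) = 0
  have hT : ∀ a b, (T a b).card ≤ 2 * (g a * g b) := by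
    intro a b
    refine card_nsmul_eq_le (by have := hgpos a; have := hgpos b; positivity) _ ?_
    intro x hx y hy
    simp only [T, Finset.mem_filter, Finset.mem_univ, true_and] at hx hy
    have h1 : a * (b * (2 * (x - y))) = 0 := by linear_combination hy - hx
    have h2 := gcd_nsmul_eq_zero h1
    have h3 : b * (g a • (2 * (x - y))) = 0 := by rw [mul_smul_comm]; exact h2
    have h4 := gcd_nsmul_eq_zero h3
    have : (2 * (g a * g b)) • (x - y) = g b • g a • (2 * (x - y)) := by
      simp only [nsmul_eq_mul]; push_cast; ring
    rw [this]; exact h4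
  calc _ ≤ (Finset.univ.sigma fun p : ZMod q × ZMod q => T p.1 p.2).card := by
        refine Finset.card_le_card_of_injOn (fun z => ⟨((z.1.1 : ZMod q) + z.1.2,
          (z.2.1 : ZMod q) - z.1.1), (z.1.1 : ZMod q)⟩) ?_ ?_
        · rintro ⟨⟨x, y⟩, ⟨z, w⟩⟩ h
          simp only [Finset.coe_filter, Finset.mem_univ, true_and, Set.mem_ofPred_eq] at h
          obtain ⟨h1, h2⟩ := h
          simp only [T, Finset.coe_sigma, Set.mem_sigma_iff, Finset.mem_coe, Finset.mem_univ,
            Finset.mem_filter, true_and]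
          have hw : (w : ZMod q) = x + y - z := by rw [h1]; ring
          have hx : (x : ZMod q) * ((x⁻¹ : (ZMod q)ˣ) : ZMod q) = 1 := x.mul_inv
          have hy : (y : ZMod q) * ((y⁻¹ : (ZMod q)ˣ) : ZMod q) = 1 := y.mul_inv
          have hz : (z : ZMod q) * ((z⁻¹ : (ZMod q)ˣ) : ZMod q) = 1 := z.mul_inv
          have hw' : (w : ZMod q) * ((w⁻¹ : (ZMod q)ˣ) : ZMod q) = 1 := w.mul_inv
          have e1 : ((x : ZMod q) + y) * (z * w) = (z + w) * (x * y) := by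
            have := congrArg (fun t => t * ((x : ZMod q) * y * z * w)) h2
            linear_combination this - (y * z * w : ZMod q) * hx - (x * z * w : ZMod q) * hy +
              (x * y * w : ZMod q) * hz + (x * y * z : ZMod q) * hw'
          rw [hw] at e1
          linear_combination e1
        · rintro ⟨⟨x, y⟩, ⟨z, w⟩⟩ h ⟨⟨x', y'⟩, ⟨z', w'⟩⟩ h' he
          simp only [Finset.coe_filter, Finset.mem_univ, true_and, Set.mem_ofPred_eq] at h h'
          simp only [Sigma.mk.injEq, Prod.mk.injEq, heq_eq_eq] at he
          obtain ⟨⟨ha, hb⟩, hx⟩ := he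
          have hy : (y : ZMod q) = y' := by linear_combination ha - hx
          have hz : (z : ZMod q) = z' := by linear_combination hb + hx
          have hw : (w : ZMod q) = w' := by linear_combination h'.1 - h.1 + ha - hz
          simp [Units.ext hx, Units.ext hy, Units.ext hz, Units.ext hw]
    _ = ∑ p : ZMod q × ZMod q, (T p.1 p.2).card := Finset.card_sigma _ _
    _ ≤ ∑ p : ZMod q × ZMod q, 2 * (g p.1 * g p.2) := Finset.sum_le_sum fun p _ => hT _ _
    _ = 2 * (∑ a, g a) ^ 2 := by
        rw [← Finset.mul_sum, sq, Finset.sum_mul_sum, ← Finset.univ_product_univ,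
          Finset.sum_product]
    _ ≤ _ := by gcongr; exact sum_gcd_le q

/-- The square of a Kloosterman sum is an exponential sum over pairs of units at the points (x + y,
x⁻¹ + y⁻¹), so its fourth moment is a second moment, that is, a count of coincidences. -/
theorem sum_norm_kloosterman_pow_four_le (q : ℕ) [NeZero q] :
    ∑ h : ZMod q, ∑ k : ZMod q, ‖kloosterman h k‖ ^ 4 ≤
      2 * (q : ℝ) ^ 4 * (q.divisors.card : ℝ) ^ 2 := by
  have h1 : ∀ h k : ZMod q, ‖kloosterman h k‖ ^ 4 =
      ‖∑ z : (ZMod q)ˣ × (ZMod q)ˣ, ZMod.stdAddChar (h * ((z.1 : ZMod q) + (z.2 : ZMod q)) +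
        k * (((z.1⁻¹ : (ZMod q)ˣ) : ZMod q) + ((z.2⁻¹ : (ZMod q)ˣ) : ZMod q)))‖ ^ 2 := by
    intro h k
    have : (∑ z : (ZMod q)ˣ × (ZMod q)ˣ, ZMod.stdAddChar (h * ((z.1 : ZMod q) + (z.2 : ZMod q)) +
        k * (((z.1⁻¹ : (ZMod q)ˣ) : ZMod q) + ((z.2⁻¹ : (ZMod q)ˣ) : ZMod q)))) =
        kloosterman h k * kloosterman h k := by
      unfold kloosterman
      rw [Finset.sum_mul_sum, ← Finset.univ_product_univ, Finset.sum_product]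
      refine Finset.sum_congr rfl fun i _ => Finset.sum_congr rfl fun j _ => ?_
      rw [← AddChar.map_add_eq_mul]; congr 1; ring
    rw [this, norm_mul]; ring
  simp_rw [h1]
  rw [sum_norm_sq_expSum (fun z : (ZMod q)ˣ × (ZMod q)ˣ => (z.1 : ZMod q) + (z.2 : ZMod q))
    (fun z => ((z.1⁻¹ : (ZMod q)ˣ) : ZMod q) + ((z.2⁻¹ : (ZMod q)ˣ) : ZMod q))]
  have := card_add_eq_add_inv_le q
  have h2 : ((Finset.univ.filter fun z : ((ZMod q)ˣ × (ZMod q)ˣ) × ((ZMod q)ˣ × (ZMod q)ˣ) =>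
      (z.1.1 : ZMod q) + z.1.2 = z.2.1 + z.2.2 ∧
      ((z.1.1⁻¹ : (ZMod q)ˣ) : ZMod q) + ((z.1.2⁻¹ : (ZMod q)ˣ) : ZMod q) =
        ((z.2.1⁻¹ : (ZMod q)ˣ) : ZMod q) + ((z.2.2⁻¹ : (ZMod q)ˣ) : ZMod q)).card : ℝ) ≤
      2 * (q * q.divisors.card) ^ 2 := by exact_mod_cast this
  calc _ ≤ (q : ℝ) ^ 2 * (2 * (q * q.divisors.card) ^ 2) := by gcongr
    _ = _ := by ring

/-- Sum over the orbit of (h, k), where the sum is constant, and enlarge to all frequencies. A point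
is hit at most |k| times, since k(u⁻¹ - v⁻¹) = 0 for any two parameters u, v that lead to it. -/
theorem norm_kloosterman_pow_four_mul_totient_le {q : ℕ} [NeZero q] (h : ZMod q) {k : ℤ}
    (hk : k ≠ 0) :
    ‖kloosterman h (k : ZMod q)‖ ^ 4 * q.totient ≤
      k.natAbs * (2 * (q : ℝ) ^ 4 * (q.divisors.card : ℝ) ^ 2) := by
  classical
  let φ : (ZMod q)ˣ → ZMod q × ZMod q := fun u =>
    (h * (u : ZMod q), (k : ZMod q) * ((u⁻¹ : (ZMod q)ˣ) : ZMod q))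
  have hfib : ∀ p : ZMod q × ZMod q, (Finset.univ.filter fun u => φ u = p).card ≤ k.natAbs := by
    intro p
    rw [← Finset.card_image_of_injective (f := fun u : (ZMod q)ˣ => ((u⁻¹ : (ZMod q)ˣ) : ZMod q)) _
      (fun a b hab => inv_injective (Units.ext hab))]
    refine card_nsmul_eq_le (Int.natAbs_pos.2 hk) _ ?_
    intro x hx y hy
    simp only [Finset.mem_image, Finset.mem_filter, Finset.mem_univ, true_and] at hx hy
    obtain ⟨u, hu, rfl⟩ := hx
    obtain ⟨v, hv, rfl⟩ := hy
    have h0 : (k : ZMod q) * (((u⁻¹ : (ZMod q)ˣ) : ZMod q) - ((v⁻¹ : (ZMod q)ˣ) : ZMod q)) = 0 := by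
      have := congrArg Prod.snd (hu.trans hv.symm)
      simp only [φ] at this
      rw [mul_sub, this, sub_self]
    rw [nsmul_eq_mul]
    rcases Int.natAbs_eq k with hk' | hk'
    · rw [hk'] at h0; simpa using h0
    · rw [hk'] at h0; simpa using h0
  calc ‖kloosterman h (k : ZMod q)‖ ^ 4 * q.totient
      = ∑ u : (ZMod q)ˣ, ‖kloosterman (φ u).1 (φ u).2‖ ^ 4 := by
        simp only [φ, kloosterman_smul, Finset.sum_const, nsmul_eq_mul, Finset.card_univ,
          ZMod.card_units_eq_totient]
        ring
    _ = ∑ p : ZMod q × ZMod q, ∑ u ∈ Finset.univ.filter (fun u => φ u = p),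
          ‖kloosterman (φ u).1 (φ u).2‖ ^ 4 := (Finset.sum_fiberwise _ _ _).symm
    _ = ∑ p : ZMod q × ZMod q, ((Finset.univ.filter (fun u => φ u = p)).card : ℝ) *
          ‖kloosterman p.1 p.2‖ ^ 4 := by
        refine Finset.sum_congr rfl fun p _ => ?_
        rw [← nsmul_eq_mul, ← Finset.sum_const]
        refine Finset.sum_congr rfl fun u hu => ?_
        rw [(Finset.mem_filter.1 hu).2]
    _ ≤ ∑ p : ZMod q × ZMod q, (k.natAbs : ℝ) * ‖kloosterman p.1 p.2‖ ^ 4 := by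
        refine Finset.sum_le_sum fun p _ => ?_
        gcongr
        exact hfib p
    _ = k.natAbs * ∑ h : ZMod q, ∑ k : ZMod q, ‖kloosterman h k‖ ^ 4 := by
        rw [← Finset.mul_sum, ← Finset.univ_product_univ, Finset.sum_product]
    _ ≤ _ := by gcongr; exact sum_norm_kloosterman_pow_four_le q

/-- A Kloosterman bound with a power saving, uniform in `h`. -/
theorem norm_kloosterman_le_rpow {q : ℕ} [NeZero q] (h : ZMod q) {k : ℤ} (hk : k ≠ 0) :
    ‖kloosterman h (k : ZMod q)‖ ≤ 2 * k.natAbs * q.divisors.card * (q : ℝ) ^ (4 / 5 : ℝ) := by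
  have h1 := norm_kloosterman_pow_four_mul_totient_le h hk
  have h2 := norm_kloosterman_le h (k : ZMod q)
  have hq : 0 < q := Nat.pos_of_ne_zero (NeZero.ne q)
  have hτ : (1 : ℝ) ≤ q.divisors.card := by
    exact_mod_cast Finset.card_pos.2 ⟨1, by simp [hq.ne']⟩
  have hk1 : (1 : ℝ) ≤ k.natAbs := by exact_mod_cast Int.natAbs_pos.2 hk
  -- In the fifth power one factor is bounded trivially by φ(q), which is exactly the weight in the
  -- fourth-power bound. No lower bound for φ(q) is needed, and q⁴ yields the exponent 4/5.
  refine le_of_pow_le_pow_left₀ (n := 5) (by norm_num) (by positivity) ?_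
  have h3 : ((q : ℝ) ^ (4 / 5 : ℝ)) ^ 5 = (q : ℝ) ^ 4 := by
    rw [← Real.rpow_natCast, ← Real.rpow_mul (by positivity)]
    norm_num
  rw [mul_pow, h3]
  set K : ℝ := (k.natAbs : ℝ)
  set τ : ℝ := (q.divisors.card : ℝ)
  calc ‖kloosterman h (k : ZMod q)‖ ^ 5
      = ‖kloosterman h (k : ZMod q)‖ ^ 4 * ‖kloosterman h (k : ZMod q)‖ := by ring
    _ ≤ ‖kloosterman h (k : ZMod q)‖ ^ 4 * q.totient := by gcongr
    _ ≤ K * (2 * (q : ℝ) ^ 4 * τ ^ 2) := h1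
    _ = (2 * K * τ ^ 2) * (q : ℝ) ^ 4 := by ring
    _ ≤ (2 * K * τ) ^ 5 * (q : ℝ) ^ 4 := by
        gcongr
        have e1 : τ ^ 2 ≤ τ ^ 5 := pow_le_pow_right₀ hτ (by norm_num)
        have e2 : 2 * K ≤ (2 * K) ^ 5 := le_self_pow₀ (by linarith) (by norm_num)
        calc 2 * K * τ ^ 2 ≤ (2 * K) ^ 5 * τ ^ 5 := by gcongr
          _ = _ := by ring

/-! ### Completion of incomplete Kloosterman sums -/

theorem norm_stdAddChar_sub_one {q : ℕ} [NeZero q] (h : ZMod q) :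
    ‖(ZMod.stdAddChar h : ℂ) - 1‖ = 2 * Real.sin (Real.pi * (h.val / q)) := by
  have hq : (0 : ℝ) < q := by exact_mod_cast Nat.pos_of_ne_zero (NeZero.ne q)
  have e : (ZMod.stdAddChar h : ℂ) =
      Complex.exp (Complex.I * ((2 * (Real.pi * (h.val / q)) : ℝ) : ℂ)) := by
    conv_lhs => rw [← ZMod.natCast_zmod_val h, ← Int.cast_natCast, ZMod.stdAddChar_coe]
    congr 1; push_cast; ring
  rw [e, Complex.norm_exp_I_mul_ofReal_sub_one, mul_div_cancel_left₀ _ two_ne_zero, norm_mul]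
  have hv : (h.val : ℝ) / q ≤ 1 := by
    rw [div_le_one hq]; exact_mod_cast (ZMod.val_lt h).le
  have : 0 ≤ Real.sin (Real.pi * (h.val / q)) :=
    Real.sin_nonneg_of_nonneg_of_le_pi (by positivity) (by nlinarith [Real.pi_pos])
  rw [Real.norm_of_nonneg this]; norm_num

/-- Chord estimate: `sin (π v) ≥ 2 min(v, 1 - v)`, in the form used for geometric sums. -/
theorem one_div_sin_le {v : ℝ} (h0 : 0 < v) (h1 : v < 1) :
    1 / Real.sin (Real.pi * v) ≤ (1 / v + 1 / (1 - v)) / 2 := by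
  have hpi := Real.pi_pos
  have h1' : 0 < 1 - v := by linarith
  have key : ∀ w : ℝ, 0 < w → w ≤ 1 / 2 → 1 / Real.sin (Real.pi * w) ≤ 1 / w / 2 := by
    intro w hw hw2
    have := Real.mul_le_sin (x := Real.pi * w) (by positivity) (by nlinarith)
    have e : 2 / Real.pi * (Real.pi * w) = 2 * w := by field_simp
    rw [e] at this
    rw [div_div, mul_comm w 2]
    exact one_div_le_one_div_of_le (by positivity) this
  rcases le_total v (1 / 2) with h | h
  · have := key v h0 h
    have : 0 < 1 / (1 - v) := by positivity
    linarith
  · have h2 := key (1 - v) h1' (by linarith)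
    rw [show Real.pi * (1 - v) = Real.pi - Real.pi * v by ring, Real.sin_pi_sub] at h2
    have : 0 < 1 / v := by positivity
    linarith

theorem sum_zmod_val {q : ℕ} [NeZero q] (f : ℕ → ℝ) :
    ∑ h : ZMod q, f h.val = ∑ v ∈ Finset.range q, f v := by
  refine Finset.sum_nbij' (fun h => h.val) (fun v => (v : ZMod q)) ?_ ?_ ?_ ?_ ?_
  · intro h _; exact Finset.mem_range.2 (ZMod.val_lt h)
  · intro v _; exact Finset.mem_univ _
  · intro h _; exact ZMod.natCast_zmod_val h
  · intro v hv; exact ZMod.val_cast_of_lt (Finset.mem_range.1 hv)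
  · intro h _; rfl

/-- The `L¹` norm of the Dirichlet kernel modulo `q`. -/
theorem sum_norm_geom_le {q : ℕ} [NeZero q] {a b : ℕ} (hab : b ≤ a + q) :
    ∑ h : ZMod q, ‖∑ n ∈ Finset.Ico a b, (ZMod.stdAddChar (-(h * (n : ZMod q))) : ℂ)‖ ≤
      q * (2 + Real.log q) := by
  have hq0 : 0 < q := Nat.pos_of_ne_zero (NeZero.ne q)
  have hq : (0 : ℝ) < q := by exact_mod_cast hq0
  -- Majorant: at frequency zero the length of the interval, at most q; elsewhere 1 / sin(πv / q),
  -- bounded by the chord estimate.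
  let φ : ℕ → ℝ := fun v => if v = 0 then (q : ℝ) else (q / 2 : ℝ) * ((v : ℝ)⁻¹ + ((q - v : ℕ) : ℝ)⁻¹)
  have hD : ∀ h : ZMod q, ‖∑ n ∈ Finset.Ico a b, (ZMod.stdAddChar (-(h * (n : ZMod q))) : ℂ)‖ ≤ φ h.val := by
    intro h
    by_cases h0 : h = 0
    · subst h0
      simp only [φ, ZMod.val_zero, if_true, zero_mul, neg_zero, AddChar.map_zero_eq_one,
        Finset.sum_const, Nat.card_Ico, nsmul_eq_mul, mul_one, Complex.norm_natCast]
      exact_mod_cast (by omega : b - a ≤ q)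
    · have hv0 : h.val ≠ 0 := by rwa [Ne, ZMod.val_eq_zero]
      have hvq := ZMod.val_lt h
      set v : ℝ := (h.val : ℝ) / q with hv
      have hvpos : 0 < v := by
        have : (0 : ℝ) < h.val := by exact_mod_cast Nat.pos_of_ne_zero hv0
        positivity
      have hv1 : v < 1 := by rw [hv, div_lt_one hq]; exact_mod_cast hvq
      have hsin : 0 < Real.sin (Real.pi * v) :=
        Real.sin_pos_of_pos_of_lt_pi (by positivity) (by nlinarith [Real.pi_pos])
      have hnorm := norm_stdAddChar_sub_one h
      set z : ℂ := ZMod.stdAddChar (-h) with hz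
      have hz1 : ‖z‖ = 1 := AddChar.norm_apply _ _
      have hzn : ∀ n : ℕ, (ZMod.stdAddChar (-(h * (n : ZMod q))) : ℂ) = z ^ n := by
        intro n
        rw [hz, ← AddChar.map_nsmul_eq_pow, nsmul_eq_mul]; congr 1; ring
      have hconj : ‖z - 1‖ = 2 * Real.sin (Real.pi * v) := by
        rw [← hnorm, hz, AddChar.map_neg_eq_conj, ← Complex.norm_conj (_ - 1)]
        simp
      simp_rw [hzn]
      have hmul : ‖∑ n ∈ Finset.Ico a b, z ^ n‖ * ‖z - 1‖ ≤ 2 := by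
        rw [← norm_mul]
        rcases le_total a b with hle | hle
        · rw [geom_sum_Ico_mul z hle]
          refine (norm_sub_le _ _).trans ?_
          rw [norm_pow, norm_pow, hz1, one_pow, one_pow]; norm_num
        · rw [Finset.Ico_eq_empty_of_le hle]; simp
      have : ‖∑ n ∈ Finset.Ico a b, z ^ n‖ ≤ 1 / Real.sin (Real.pi * v) := by
        rw [le_div_iff₀ hsin]; rw [hconj] at hmul; linarith
      refine this.trans ((one_div_sin_le hvpos hv1).trans (le_of_eq ?_))
      simp only [φ, if_neg hv0]
      rw [Nat.cast_sub hvq.le, hv]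
      have : (q : ℝ) - h.val ≠ 0 := by
        have : (h.val : ℝ) < q := by exact_mod_cast hvq
        linarith
      have : (h.val : ℝ) ≠ 0 := by exact_mod_cast hv0
      field_simp
  have hH : ∑ v ∈ Finset.range (q - 1), ((v + 1 : ℕ) : ℝ)⁻¹ ≤ 1 + Real.log q := by
    have h1 := harmonic_le_one_add_log (q - 1)
    have h2 : ((harmonic (q - 1) : ℚ) : ℝ) = ∑ v ∈ Finset.range (q - 1), ((v + 1 : ℕ) : ℝ)⁻¹ := by
      simp [harmonic]
    rw [← h2]
    refine h1.trans ?_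
    rcases Nat.eq_zero_or_pos (q - 1) with h | h
    · rw [h]; simpa using Real.log_nonneg (by exact_mod_cast hq0)
    · gcongr; exact Nat.sub_le _ _
  calc _ ≤ ∑ h : ZMod q, φ h.val := Finset.sum_le_sum fun h _ => hD h
    _ = ∑ v ∈ Finset.range q, φ v := sum_zmod_val φ
    _ = ∑ v ∈ Finset.range (q - 1), φ (v + 1) + φ 0 := by
        rw [← Finset.sum_range_succ', Nat.sub_add_cancel hq0]
    _ = (q / 2 : ℝ) * (∑ v ∈ Finset.range (q - 1), ((v + 1 : ℕ) : ℝ)⁻¹ +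
          ∑ v ∈ Finset.range (q - 1), ((v + 1 : ℕ) : ℝ)⁻¹) + q := by
        have hr := Finset.sum_range_reflect (fun v => ((v + 1 : ℕ) : ℝ)⁻¹) (q - 1)
        nth_rewrite 2 [← hr]
        rw [← Finset.sum_add_distrib, Finset.mul_sum]
        congr 1
        refine Finset.sum_congr rfl fun v hv => ?_
        have := Finset.mem_range.1 hv
        simp only [φ, if_neg (Nat.succ_ne_zero v)]
        rw [show q - (v + 1) = q - 1 - 1 - v + 1 by omega]
    _ ≤ (q / 2 : ℝ) * ((1 + Real.log q) + (1 + Real.log q)) + q := by gcongr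
    _ = _ := by ring

/-- Completion of an incomplete Kloosterman sum. -/
theorem norm_incomplete_kloosterman_le {q : ℕ} [NeZero q] {k : ℤ} (hk : k ≠ 0) {a b : ℕ}
    (hab : b ≤ a + q) :
    ‖∑ n ∈ (Finset.Ico a b).filter (fun n => Nat.Coprime n q),
      (ZMod.stdAddChar ((k : ZMod q) * (n : ZMod q)⁻¹) : ℂ)‖ ≤
      (2 + Real.log q) * (2 * k.natAbs * q.divisors.card * (q : ℝ) ^ (4 / 5 : ℝ)) := by
  classical
  have hq : (0 : ℝ) < q := by exact_mod_cast Nat.pos_of_ne_zero (NeZero.ne q)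
  -- The condition x = n on a unit x is detected by additive characters, and the sum over x becomes
  -- a complete Kloosterman sum. If n is not coprime to q, no unit matches and both sides vanish.
  have hterm : ∀ n : ℕ, (if Nat.Coprime n q then
      (ZMod.stdAddChar ((k : ZMod q) * (n : ZMod q)⁻¹) : ℂ) else 0) =
      (q : ℂ)⁻¹ * ∑ h : ZMod q, ZMod.stdAddChar (-(h * (n : ZMod q))) * kloosterman h (k : ZMod q) := by
    intro n
    have h1 : ∑ h : ZMod q, ZMod.stdAddChar (-(h * (n : ZMod q))) * kloosterman h (k : ZMod q) =
        ∑ x : (ZMod q)ˣ, (if (x : ZMod q) = n then (q : ℂ) else 0) *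
          ZMod.stdAddChar ((k : ZMod q) * ((x⁻¹ : (ZMod q)ˣ) : ZMod q)) := by
      simp only [kloosterman, Finset.mul_sum]
      rw [Finset.sum_comm]
      refine Finset.sum_congr rfl fun x _ => ?_
      have := AddChar.sum_mulShift ((x : ZMod q) - n) (ZMod.isPrimitive_stdAddChar q)
      simp only [sub_eq_zero, ZMod.card, Nat.cast_ite, Nat.cast_zero] at this
      rw [← this, Finset.sum_mul]
      refine Finset.sum_congr rfl fun h _ => ?_
      rw [← AddChar.map_add_eq_mul, ← AddChar.map_add_eq_mul]; congr 1; ring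
    rw [h1]
    split_ifs with hc
    · have : ∀ x : (ZMod q)ˣ, ((x : ZMod q) = n) ↔ x = ZMod.unitOfCoprime n hc := fun x => by
        rw [Units.ext_iff, ZMod.coe_unitOfCoprime]
      simp only [this, ite_mul, zero_mul, Finset.sum_ite_eq', Finset.mem_univ, if_true]
      rw [← mul_assoc, inv_mul_cancel₀ (by exact_mod_cast hq.ne'), one_mul, ← ZMod.inv_coe_unit,
        ZMod.coe_unitOfCoprime]
    · have : ∀ x : (ZMod q)ˣ, ¬ ((x : ZMod q) = n) := fun x hx =>
        hc ((ZMod.isUnit_iff_coprime n q).1 (hx ▸ x.isUnit))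
      simp [this]
  rw [Finset.sum_filter]
  simp_rw [hterm]
  rw [← Finset.mul_sum, Finset.sum_comm]
  simp_rw [← Finset.sum_mul]
  rw [norm_mul, norm_inv, Complex.norm_natCast]
  set B : ℝ := 2 * k.natAbs * q.divisors.card * (q : ℝ) ^ (4 / 5 : ℝ)
  have hB : 0 ≤ B := by positivity
  calc _ ≤ (q : ℝ)⁻¹ * ∑ h : ZMod q,
        ‖∑ n ∈ Finset.Ico a b, (ZMod.stdAddChar (-(h * (n : ZMod q))) : ℂ)‖ * B := by
        gcongr
        refine (norm_sum_le _ _).trans (Finset.sum_le_sum fun h _ => ?_)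
        rw [norm_mul]
        gcongr
        exact norm_kloosterman_le_rpow h hk
    _ ≤ (q : ℝ)⁻¹ * ((q * (2 + Real.log q)) * B) := by
        rw [← Finset.sum_mul]; gcongr; exact sum_norm_geom_le hab
    _ = _ := by field_simp

/-! ### Weyl sums of Farey fractions, averaged over the moduli -/

theorem sum_card_divisors_le (Q : ℕ) :
    ∑ q ∈ Finset.Ioc 0 Q, (q.divisors.card : ℝ) ≤ Q * (1 + Real.log Q) := by
  have h1 : ∀ q ∈ Finset.Ioc 0 Q, (q.divisors.card : ℝ) =
      ∑ d ∈ Finset.Ioc 0 Q, if d ∣ q then (1 : ℝ) else 0 := by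
    intro q hq
    rw [Finset.mem_Ioc] at hq
    rw [Finset.sum_boole]
    congr 2
    ext d
    simp only [Nat.mem_divisors, Finset.mem_filter, Finset.mem_Ioc]
    exact ⟨fun h => ⟨⟨Nat.pos_of_dvd_of_pos h.1 hq.1, (Nat.le_of_dvd hq.1 h.1).trans hq.2⟩, h.1⟩,
      fun h => ⟨h.2, by omega⟩⟩
  rw [Finset.sum_congr rfl h1, Finset.sum_comm]
  simp_rw [Finset.sum_boole, Nat.Ioc_filter_dvd_card_eq_div]
  calc ∑ d ∈ Finset.Ioc 0 Q, ((Q / d : ℕ) : ℝ) ≤ ∑ d ∈ Finset.Ioc 0 Q, (Q : ℝ) * (d : ℝ)⁻¹ :=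
        Finset.sum_le_sum fun d _ => by rw [← div_eq_mul_inv]; exact Nat.cast_div_le
    _ = Q * ((harmonic Q : ℚ) : ℝ) := by
        rw [← Finset.mul_sum, harmonic_eq_sum_Icc]; push_cast; rfl
    _ ≤ _ := by gcongr; exact harmonic_le_one_add_log Q

/-- For coprime `q, n` the fraction `p / q ∈ [0, 1)` whose successor in a Farey sequence has
denominator `n`: its numerator solves `p n ≡ -1` modulo `q`. -/
noncomputable def leftFraction (q n : ℕ) : ℝ := ((-(n : ZMod q)⁻¹ : ZMod q).val : ℝ) / q

/-- The bridge from Weyl sums to Kloosterman sums: the numerator of `leftFraction` is a modular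
inverse. -/
theorem fourier_leftFraction (k : ℤ) {q : ℕ} [NeZero q] (n : ℕ) :
    fourier k ((leftFraction q n : ℝ) : UnitAddCircle) =
      (ZMod.stdAddChar (((-k : ℤ) : ZMod q) * (n : ZMod q)⁻¹) : ℂ) := by
  have e : ((-k : ℤ) : ZMod q) * (n : ZMod q)⁻¹ =
      ((k * (-(n : ZMod q)⁻¹ : ZMod q).val : ℤ) : ZMod q) := by
    push_cast
    rw [ZMod.natCast_zmod_val]; ring
  rw [e, ZMod.stdAddChar_coe, fourier_coe_apply, leftFraction]
  congr 1; push_cast; ring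

/-- Averaged over the moduli `q ≤ Q`, incomplete Kloosterman sums are `o(Q²)`. -/
theorem tendsto_sum_fourier_leftFraction {k : ℤ} (hk : k ≠ 0) (J : ℕ → ℕ → Finset ℕ)
    (hJ : ∀ Q q, 0 < q → q ≤ Q → ∃ a b, b ≤ a + q ∧ J Q q = Finset.Ico a b) :
    Tendsto (fun Q : ℕ => (∑ q ∈ Finset.Ioc 0 Q, ∑ n ∈ (J Q q).filter (fun n => Nat.Coprime n q),
      fourier k ((leftFraction q n : ℝ) : UnitAddCircle)) / (Q : ℂ) ^ 2) atTop (𝓝 0) := by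
  set K : ℝ := (k.natAbs : ℝ) with hK
  -- Completion gives Q^(4/5) times a logarithm times τ(q) for each modulus, and τ sums to at most
  -- Q(1 + log Q): a gain of Q^(1/5) over Q², against a squared logarithm.
  have hbound : ∀ Q : ℕ, 0 < Q → ‖(∑ q ∈ Finset.Ioc 0 Q,
      ∑ n ∈ (J Q q).filter (fun n => Nat.Coprime n q),
      fourier k ((leftFraction q n : ℝ) : UnitAddCircle)) / (Q : ℂ) ^ 2‖ ≤
      2 * K * ((2 + Real.log Q) ^ 2 / (Q : ℝ) ^ (1 / 5 : ℝ)) := by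
    intro Q hQ
    have hQ' : (0 : ℝ) < Q := by exact_mod_cast hQ
    have hlog : 0 ≤ Real.log Q := Real.log_nonneg (by exact_mod_cast hQ)
    rw [norm_div, norm_pow, Complex.norm_natCast, div_le_iff₀ (by positivity)]
    have h1 : ∀ q ∈ Finset.Ioc 0 Q, ‖∑ n ∈ (J Q q).filter (fun n => Nat.Coprime n q),
        fourier k ((leftFraction q n : ℝ) : UnitAddCircle)‖ ≤
        (2 + Real.log Q) * (2 * K) * (Q : ℝ) ^ (4 / 5 : ℝ) * (q.divisors.card : ℝ) := by
      intro q hq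
      rw [Finset.mem_Ioc] at hq
      have : NeZero q := ⟨hq.1.ne'⟩
      obtain ⟨a, b, hab, hJe⟩ := hJ Q q hq.1 hq.2
      simp_rw [fourier_leftFraction, hJe]
      refine (norm_incomplete_kloosterman_le (neg_ne_zero.2 hk) hab).trans ?_
      rw [Int.natAbs_neg, ← hK]
      have hq1 : (0 : ℝ) < q := by exact_mod_cast hq.1
      have hqQ : (q : ℝ) ≤ Q := by exact_mod_cast hq.2
      calc (2 + Real.log q) * (2 * K * q.divisors.card * (q : ℝ) ^ (4 / 5 : ℝ))
          ≤ (2 + Real.log Q) * (2 * K * q.divisors.card * (Q : ℝ) ^ (4 / 5 : ℝ)) := by gcongr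
        _ = _ := by ring
    calc _ ≤ ∑ q ∈ Finset.Ioc 0 Q,
          (2 + Real.log Q) * (2 * K) * (Q : ℝ) ^ (4 / 5 : ℝ) * (q.divisors.card : ℝ) :=
          (norm_sum_le _ _).trans (Finset.sum_le_sum h1)
      _ ≤ (2 + Real.log Q) * (2 * K) * (Q : ℝ) ^ (4 / 5 : ℝ) * (Q * (2 + Real.log Q)) := by
          rw [← Finset.mul_sum]
          gcongr
          refine (sum_card_divisors_le Q).trans ?_
          gcongr; norm_num
      _ = _ := by
          have e : (Q : ℝ) ^ (4 / 5 : ℝ) * (Q : ℝ) ^ (1 / 5 : ℝ) = Q := by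
            rw [← Real.rpow_add hQ']; norm_num
          have hp : (0 : ℝ) < (Q : ℝ) ^ (1 / 5 : ℝ) := by positivity
          have hX : (Q : ℝ) ^ (4 / 5 : ℝ) = Q / (Q : ℝ) ^ (1 / 5 : ℝ) := by
            rw [eq_div_iff hp.ne', e]
          rw [hX]; ring
  have hlim : Tendsto (fun Q : ℕ => 2 * K * ((2 + Real.log Q) ^ 2 / (Q : ℝ) ^ (1 / 5 : ℝ)))
      atTop (𝓝 0) := by
    have h1 : Tendsto (fun x : ℝ => (2 + Real.log x) / x ^ (1 / 10 : ℝ)) atTop (𝓝 0) := by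
      have a1 : Tendsto (fun x : ℝ => 2 / x ^ (1 / 10 : ℝ)) atTop (𝓝 0) :=
        (tendsto_rpow_atTop (by norm_num)).const_div_atTop 2
      have a2 : Tendsto (fun x : ℝ => Real.log x / x ^ (1 / 10 : ℝ)) atTop (𝓝 0) :=
        (isLittleO_log_rpow_atTop (by norm_num)).tendsto_div_nhds_zero
      simpa [add_div] using a1.add a2
    have h2 := ((h1.pow 2).const_mul (2 * K)).comp tendsto_natCast_atTop_atTop
    simp only [ne_eq, OfNat.ofNat_ne_zero, not_false_eq_true, zero_pow, mul_zero] at h2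
    refine h2.congr fun Q => ?_
    simp only [Function.comp_apply, div_pow]
    rw [← Real.rpow_natCast ((Q : ℝ) ^ (1 / 10 : ℝ)), ← Real.rpow_mul (by positivity)]
    norm_num
  refine squeeze_zero_norm' ?_ hlim
  filter_upwards [eventually_gt_atTop 0] with Q hQ using hbound Q hQ

/-! ### Lattice points and coprime pairs in star-shaped regions -/

open MeasureTheory Set Pointwise

open Classical in
/-- The points of `ℕ²` in the dilate `R • A` of a subset `A` of `(0, 1]²`. -/
noncomputable def latticePoints (A : Set (ℝ × ℝ)) (R : ℝ) : Finset (ℕ × ℕ) :=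
  (Finset.Ioc 0 ⌊R⌋₊ ×ˢ Finset.Ioc 0 ⌊R⌋₊).filter fun z => ((z.1 : ℝ) / R, (z.2 : ℝ) / R) ∈ A

/-- Inside the unit square the cut-off ⌊R⌋ and positivity are automatic; they only make the set
finite. -/
theorem mem_latticePoints {A : Set (ℝ × ℝ)} (hA : A ⊆ Ioc 0 1 ×ˢ Ioc 0 1) {R : ℝ} (hR : 0 < R)
    {z : ℕ × ℕ} : z ∈ latticePoints A R ↔ ((z.1 : ℝ) / R, (z.2 : ℝ) / R) ∈ A := by
  have key : ∀ n : ℕ, (n : ℝ) / R ∈ Ioc (0 : ℝ) 1 → 0 < n ∧ n ≤ ⌊R⌋₊ := by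
    intro n hn
    refine ⟨?_, ?_⟩
    · have : (0 : ℝ) < n := by
        by_contra hc
        have h0 : (n : ℝ) / R ≤ 0 := div_nonpos_of_nonpos_of_nonneg (not_lt.1 hc) hR.le
        exact absurd hn.1 (not_lt.2 h0)
      exact_mod_cast this
    · exact Nat.le_floor ((div_le_one hR).1 hn.2)
  simp only [latticePoints, Finset.mem_filter, Finset.mem_product, Finset.mem_Ioc]
  refine ⟨fun h => h.2, fun h => ⟨?_, h⟩⟩
  have := hA h
  exact ⟨key _ this.1, key _ this.2⟩

/-- Crude but valid at every scale; it supplies the summable majorant 1 / d² in the Möbius sum. -/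
theorem card_latticePoints_le (A : Set (ℝ × ℝ)) {R : ℝ} (hR : 0 ≤ R) :
    ((latticePoints A R).card : ℝ) ≤ R ^ 2 := by
  have h1 : (latticePoints A R).card ≤ ⌊R⌋₊ * ⌊R⌋₊ := by
    classical
    refine (Finset.card_filter_le _ _).trans ?_
    simp
  have h2 := Nat.floor_le hR
  calc ((latticePoints A R).card : ℝ) ≤ (⌊R⌋₊ : ℝ) * ⌊R⌋₊ := by exact_mod_cast h1
    _ ≤ R * R := by gcongr
    _ = _ := by ring

/-- Measurable subsets of `(0, 1]²` with null frontier that are star-shaped about the origin. -/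
structure IsStarRegion (A : Set (ℝ × ℝ)) : Prop where
  subset : A ⊆ Ioc 0 1 ×ˢ Ioc 0 1
  measurableSet : MeasurableSet A
  frontier : volume (frontier A) = 0
  star : ∀ r : ℝ, 0 < r → r ≤ 1 → ∀ z ∈ A, r • z ∈ A

/-- Star-shapedness makes the dilates of A increasing, which permits convergence along real R; real
scales are needed because Möbius inversion counts at R = Q / d. The rest transports the problem to
`Fin 2 → ℝ`. -/
theorem IsStarRegion.tendsto_card_latticePoints {A : Set (ℝ × ℝ)} (hA : IsStarRegion A) :
    Tendsto (fun R : ℝ => ((latticePoints A R).card : ℝ) / R ^ 2) atTop (𝓝 (volume.real A)) := by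
  let e : (Fin 2 → ℝ) ≃ᵐ ℝ × ℝ := MeasurableEquiv.finTwoArrow
  have he : MeasurePreserving e volume volume := volume_preserving_finTwoArrow ℝ
  let eh : (Fin 2 → ℝ) ≃ₜ ℝ × ℝ := (ContinuousLinearEquiv.finTwoArrow ℝ ℝ).toHomeomorph
  have heh : (e : (Fin 2 → ℝ) → ℝ × ℝ) = eh := rfl
  have heq : ∀ x, e x = (x 0, x 1) := fun x => rfl
  set s : Set (Fin 2 → ℝ) := e ⁻¹' A with hs
  have h1 : Bornology.IsBounded s := by
    refine (Metric.isBounded_Icc (0 : Fin 2 → ℝ) 1).subset ?_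
    intro x hx
    have := hA.subset hx
    rw [heq] at this
    refine ⟨fun i => ?_, fun i => ?_⟩ <;> fin_cases i
    · exact this.1.1.le
    · exact this.2.1.le
    · exact this.1.2
    · exact this.2.2
  have h2 : MeasurableSet s := e.measurable hA.measurableSet
  have h3 : volume (_root_.frontier s) = 0 := by
    rw [hs, heh, ← eh.preimage_frontier, ← heh, he.measure_preimage_equiv, hA.frontier]
  have h4 : ∀ ⦃x y : ℝ⦄, 0 < x → x ≤ y → x • s ⊆ y • s := by
    intro x y hx hxy
    have hy : 0 < y := hx.trans_le hxy
    rintro _ ⟨z, hz, rfl⟩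
    refine ⟨(x / y) • z, ?_, ?_⟩
    · exact hA.star (x / y) (by positivity) ((div_le_one hy).2 hxy) _ hz
    · simp only [smul_smul]; rw [mul_div_cancel₀ x hy.ne']
  have hvol : volume.real s = volume.real A := by
    rw [measureReal_def, measureReal_def, hs, he.measure_preimage_equiv]
  have hmain := tendsto_card_div_pow_atTop_volume' s h1 h2 h3 h4
  rw [hvol] at hmain
  refine hmain.congr' ?_
  filter_upwards [eventually_gt_atTop 0] with R hR
  rw [Fintype.card_fin]
  congr 2
  rw [← Nat.card_eq_finsetCard]
  let f : ℕ × ℕ → (Fin 2 → ℝ) := fun z => ![(z.1 : ℝ) / R, (z.2 : ℝ) / R]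
  have hf : Function.Injective f := by
    intro z w h
    have a0 := congrFun h 0
    have a1 := congrFun h 1
    simp only [f, Matrix.cons_val_zero, Matrix.cons_val_one] at a0 a1
    rw [div_left_inj' hR.ne'] at a0 a1
    exact Prod.ext (by exact_mod_cast a0) (by exact_mod_cast a1)
  have himg : s ∩ R⁻¹ • (Submodule.span ℤ (range (Pi.basisFun ℝ (Fin 2))) : Set (Fin 2 → ℝ)) =
      f '' (latticePoints A R : Set (ℕ × ℕ)) := by
    ext x
    simp only [mem_inter_iff, mem_image, Finset.mem_coe, mem_latticePoints hA.subset hR]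
    constructor
    · rintro ⟨hxs, y, hy, rfl⟩
      have hy' := (Module.Basis.mem_span_iff_repr_mem ℤ (Pi.basisFun ℝ (Fin 2)) y).1 hy
      simp only [Pi.basisFun_repr] at hy'
      obtain ⟨m, hm⟩ := hy' 0
      obtain ⟨n, hn⟩ := hy' 1
      have hsub := hA.subset hxs
      simp only [heq, Pi.smul_apply, smul_eq_mul] at hsub
      have hRi : 0 < R⁻¹ := by positivity
      have hm0 : 0 < y 0 := (mul_pos_iff_of_pos_left hRi).1 hsub.1.1
      have hn0 : 0 < y 1 := (mul_pos_iff_of_pos_left hRi).1 hsub.2.1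
      rw [← hm] at hm0
      rw [← hn] at hn0
      simp only [eq_intCast, Int.cast_pos] at hm0 hn0 hm hn
      lift m to ℕ using hm0.le
      lift n to ℕ using hn0.le
      rw [Int.cast_natCast] at hm hn
      have hfe : f (m, n) = R⁻¹ • y := by
        ext i; fin_cases i
        · simp [f, ← hm, div_eq_inv_mul]
        · simp [f, ← hn, div_eq_inv_mul]
      have hfA : e (f (m, n)) ∈ A := by rw [hfe]; exact hxs
      exact ⟨(m, n), hfA, hfe⟩
    · rintro ⟨z, hz, rfl⟩
      refine ⟨hz, ![(z.1 : ℝ), (z.2 : ℝ)], ?_, ?_⟩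
      · refine (Module.Basis.mem_span_iff_repr_mem ℤ (Pi.basisFun ℝ (Fin 2)) _).2 fun i => ?_
        simp only [Pi.basisFun_repr]
        fin_cases i
        · exact ⟨z.1, by simp⟩
        · exact ⟨z.2, by simp⟩
      · ext i; fin_cases i <;> simp [f, div_eq_inv_mul]
  rw [himg]
  exact Nat.card_image_of_injective hf _

/-- The constant `∑ μ(d) / d² = 6 / π²`. -/
noncomputable def coprimeDensity : ℝ := ∑' d : ℕ, (ArithmeticFunction.moebius d : ℝ) / (d : ℝ) ^ 2

/-- Only nonvanishing matters, since the constant cancels in the proportion. It follows from ζ(2) ·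
∑ μ(d) / d² = 1. -/
theorem coprimeDensity_ne_zero : coprimeDensity ≠ 0 := by
  intro h
  have h1 := ArithmeticFunction.LSeries_zeta_mul_Lseries_moebius (s := 2) (by norm_num)
  have h2 : LSeries (fun n => ((ArithmeticFunction.moebius n : ℤ) : ℂ)) 2 = (coprimeDensity : ℂ) := by
    rw [coprimeDensity, LSeries, Complex.ofReal_tsum]
    refine tsum_congr fun n => ?_
    rcases eq_or_ne n 0 with rfl | hn
    · simp
    · rw [LSeries.term_of_ne_zero hn]; push_cast
      congr 1
      exact_mod_cast Complex.cpow_natCast (n : ℂ) 2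
  rw [h2, h] at h1
  simp at h1

open Classical in
/-- The coprime pairs in the dilate `Q • A`. -/
noncomputable def coprimePairs (A : Set (ℝ × ℝ)) (Q : ℕ) : Finset (ℕ × ℕ) :=
  (latticePoints A Q).filter fun z => Nat.Coprime z.2 z.1

/-- Summing μ(d) over d ∣ gcd detects coprimality, and points of Q • A divisible by d correspond to
lattice points of (Q / d) • A. Terms with d > Q vanish because ⌊Q / d⌋ = 0. -/
theorem card_coprimePairs {A : Set (ℝ × ℝ)} (hA : A ⊆ Ioc 0 1 ×ˢ Ioc 0 1) {Q : ℕ} (hQ : 0 < Q) :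
    ((coprimePairs A Q).card : ℝ) =
      ∑' d : ℕ, (ArithmeticFunction.moebius d : ℝ) * (latticePoints A ((Q : ℝ) / d)).card := by
  classical
  have hQ' : (0 : ℝ) < Q := by exact_mod_cast hQ
  rw [tsum_eq_sum (s := Finset.Ioc 0 Q)]
  · have h1 : ((coprimePairs A Q).card : ℝ) = ∑ z ∈ latticePoints A Q,
        ∑ d ∈ (Finset.Ioc 0 Q).filter (fun d => d ∣ z.1 ∧ d ∣ z.2),
          (ArithmeticFunction.moebius d : ℝ) := by
      rw [coprimePairs, Finset.card_filter]
      push_cast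
      refine Finset.sum_congr rfl fun z hz => ?_
      have hz' := Finset.mem_filter.1 hz
      simp only [Finset.mem_product, Finset.mem_Ioc, Nat.floor_natCast] at hz'
      have hdiv : (Finset.Ioc 0 Q).filter (fun d => d ∣ z.1 ∧ d ∣ z.2) =
          (Nat.gcd z.2 z.1).divisors := by
        ext d
        simp only [Finset.mem_filter, Finset.mem_Ioc, Nat.mem_divisors, Nat.dvd_gcd_iff]
        have hg : Nat.gcd z.2 z.1 ≠ 0 := (Nat.gcd_pos_of_pos_left _ (by omega)).ne'
        constructor
        · rintro ⟨_, a, b⟩; exact ⟨⟨b, a⟩, hg⟩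
        · rintro ⟨⟨b, a⟩, _⟩
          have := Nat.le_of_dvd (by omega) a
          have := Nat.pos_of_dvd_of_pos a (by omega)
          exact ⟨by omega, a, b⟩
      have hμ : (∑ d ∈ (Nat.gcd z.2 z.1).divisors, ArithmeticFunction.moebius d) =
          if Nat.gcd z.2 z.1 = 1 then 1 else 0 := by
        rw [← ArithmeticFunction.coe_mul_zeta_apply, ArithmeticFunction.moebius_mul_coe_zeta,
          ArithmeticFunction.one_apply]
      rw [hdiv]
      have := congrArg (Int.cast : ℤ → ℝ) hμ
      push_cast at this
      rw [this]
    rw [h1]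
    simp_rw [Finset.sum_filter]
    rw [Finset.sum_comm]
    refine Finset.sum_congr rfl fun d hd => ?_
    have hd0 : 0 < d := (Finset.mem_Ioc.1 hd).1
    have hd0' : (0 : ℝ) < d := by exact_mod_cast hd0
    rw [← Finset.sum_filter, Finset.sum_const, nsmul_eq_mul, mul_comm]
    congr 2
    symm
    refine Finset.card_bij (fun z _ => (d * z.1, d * z.2)) ?_ ?_ ?_
    · intro z hz
      rw [mem_latticePoints hA (by positivity)] at hz
      rw [Finset.mem_filter, mem_latticePoints hA hQ']
      refine ⟨?_, dvd_mul_right _ _, dvd_mul_right _ _⟩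
      convert hz using 2 <;> · push_cast; field_simp
    · intro z _ w _ h
      simp only [Prod.mk.injEq] at h
      exact Prod.ext (Nat.eq_of_mul_eq_mul_left hd0 h.1) (Nat.eq_of_mul_eq_mul_left hd0 h.2)
    · rintro ⟨m, n⟩ h
      rw [Finset.mem_filter, mem_latticePoints hA hQ'] at h
      obtain ⟨hz, ⟨a, rfl⟩, ⟨b, rfl⟩⟩ := h
      refine ⟨(a, b), ?_, rfl⟩
      rw [mem_latticePoints hA (by positivity)]
      convert hz using 2 <;> · push_cast; field_simp
  · intro d hd
    rcases Nat.eq_zero_or_pos d with rfl | hd0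
    · simp
    · have hdQ : Q < d := by
        by_contra hc
        exact hd (Finset.mem_Ioc.2 ⟨hd0, not_lt.1 hc⟩)
      have : ⌊(Q : ℝ) / d⌋₊ = 0 := by
        rw [Nat.floor_eq_zero, div_lt_one (by exact_mod_cast hd0)]
        exact_mod_cast hdQ
      simp [latticePoints, this]

/-- The d-th term tends to μ(d) · area / d², and dominated convergence with majorant 1 / d²
exchanges limit and sum. -/
theorem IsStarRegion.tendsto_card_coprimePairs {A : Set (ℝ × ℝ)} (hA : IsStarRegion A) :
    Tendsto (fun Q : ℕ => ((coprimePairs A Q).card : ℝ) / (Q : ℝ) ^ 2) atTop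
      (𝓝 (coprimeDensity * volume.real A)) := by
  have h1 : Tendsto (fun Q : ℕ => ∑' d : ℕ, (ArithmeticFunction.moebius d : ℝ) *
      (latticePoints A ((Q : ℝ) / d)).card / (Q : ℝ) ^ 2) atTop
      (𝓝 (∑' d : ℕ, (ArithmeticFunction.moebius d : ℝ) / (d : ℝ) ^ 2 * volume.real A)) := by
    refine tendsto_tsum_of_dominated_convergence (bound := fun d : ℕ => 1 / (d : ℝ) ^ 2)
      (Real.summable_one_div_nat_pow.2 (by norm_num)) ?_ ?_
    · intro d
      rcases Nat.eq_zero_or_pos d with rfl | hd0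
      · simp
      · have hd : (0 : ℝ) < d := by exact_mod_cast hd0
        have hR : Tendsto (fun Q : ℕ => (Q : ℝ) / d) atTop atTop :=
          tendsto_natCast_atTop_atTop.atTop_div_const hd
        refine ((hA.tendsto_card_latticePoints.comp hR).const_mul
          ((ArithmeticFunction.moebius d : ℝ) / (d : ℝ) ^ 2)).congr fun Q => ?_
        simp only [Function.comp_apply]
        field_simp
    · filter_upwards [eventually_gt_atTop 0] with Q hQ d
      have hQ' : (0 : ℝ) < Q := by exact_mod_cast hQ
      have hm : |(ArithmeticFunction.moebius d : ℝ)| ≤ 1 := by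
        exact_mod_cast ArithmeticFunction.abs_moebius_le_one
      have hc := card_latticePoints_le A (R := (Q : ℝ) / d) (by positivity)
      rw [Real.norm_eq_abs, abs_div, abs_mul, Nat.abs_cast, abs_of_pos (by positivity : (0:ℝ) < (Q : ℝ) ^ 2),
        div_le_iff₀ (by positivity)]
      calc _ ≤ 1 * ((Q : ℝ) / d) ^ 2 := by gcongr
        _ = _ := by rw [div_pow]; ring
  rw [tsum_mul_right] at h1
  refine h1.congr' ?_
  filter_upwards [eventually_gt_atTop 0] with Q hQ
  rw [card_coprimePairs hA.subset hQ, tsum_div_const]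

/-! ### Weyl's criterion -/

theorem integral_fourier_of_ne_zero {k : ℤ} (hk : k ≠ 0) :
    ∫ x in (0 : ℝ)..1, fourier k (x : UnitAddCircle) = 0 := by
  have hc : (2 * Real.pi * Complex.I * k : ℂ) ≠ 0 := by
    simp [Real.pi_ne_zero, hk]
  have h1 : ∀ x : ℝ, fourier k (x : UnitAddCircle) =
      Complex.exp ((2 * Real.pi * Complex.I * k : ℂ) * x) := fun x => by
    rw [fourier_coe_apply]; simp
  simp_rw [h1]
  rw [integral_exp_mul_complex hc]
  have : Complex.exp (2 * Real.pi * Complex.I * k * (1 : ℝ)) = 1 := by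
    rw [Complex.exp_eq_one_iff]; exact ⟨k, by push_cast; ring⟩
  rw [this]; simp

theorem continuous_coe_unitAddCircle (g : C(UnitAddCircle, ℂ)) :
    Continuous fun x : ℝ => g (x : UnitAddCircle) :=
  g.continuous.comp (AddCircle.continuous_mk' 1)

section Weyl

variable {ι : Type*} {P : ℕ → Finset ι} {θ : ι → ℝ} {s : ℕ → ℝ} {V : ℝ}

/-- Weyl's criterion, tested against continuous functions on the circle. -/
theorem tendsto_sum_continuous_of_weyl (hs : ∀ᶠ Q in atTop, 0 < s Q)
    (hV : Tendsto (fun Q => ((P Q).card : ℝ) / s Q) atTop (𝓝 V))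
    (hW : ∀ k : ℤ, k ≠ 0 → Tendsto (fun Q => (∑ z ∈ P Q, fourier k ((θ z : ℝ) : UnitAddCircle)) /
      (s Q : ℂ)) atTop (𝓝 0)) (g : C(UnitAddCircle, ℂ)) :
    Tendsto (fun Q => (∑ z ∈ P Q, g (θ z : UnitAddCircle)) / (s Q : ℂ)) atTop
      (𝓝 (V * ∫ x in (0 : ℝ)..1, g (x : UnitAddCircle))) := by
  -- The test functions with the desired limit form a subspace containing the Fourier monomials,
  -- hence all trigonometric polynomials, which are uniformly dense.
  let S : Submodule ℂ C(UnitAddCircle, ℂ) :=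
    { carrier := {g | Tendsto (fun Q => (∑ z ∈ P Q, g (θ z : UnitAddCircle)) / (s Q : ℂ)) atTop
        (𝓝 (V * ∫ x in (0 : ℝ)..1, g (x : UnitAddCircle)))}
      add_mem' := by
        intro f g hf hg
        have h := Tendsto.add hf hg
        rw [← mul_add, ← intervalIntegral.integral_add
          ((continuous_coe_unitAddCircle f).intervalIntegrable _ _)
          ((continuous_coe_unitAddCircle g).intervalIntegrable _ _)] at h
        refine h.congr fun Q => ?_
        simp [Finset.sum_add_distrib, add_div]
      zero_mem' := by simp
      smul_mem' := by
        intro c f hf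
        have h := Tendsto.const_mul c hf
        rw [mul_left_comm, ← intervalIntegral.integral_const_mul] at h
        refine h.congr fun Q => ?_
        simp [← Finset.mul_sum, mul_div_assoc] }
  have hspan : Submodule.span ℂ (range (@fourier 1)) ≤ S := by
    rw [Submodule.span_le]
    rintro _ ⟨k, rfl⟩
    change Tendsto _ _ _
    rcases eq_or_ne k 0 with rfl | hk
    · have : Tendsto (fun Q => (((P Q).card : ℝ) / s Q : ℝ)) atTop (𝓝 V) := hV
      have h2 := (Complex.continuous_ofReal.tendsto V).comp this
      simpa [Function.comp_def] using h2
    · rw [integral_fourier_of_ne_zero hk, mul_zero]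
      exact hW k hk
  have hg : g ∈ (Submodule.span ℂ (range (@fourier 1))).topologicalClosure := by
    rw [span_fourier_closure_eq_top]; trivial
  rw [← SetLike.mem_coe, Submodule.topologicalClosure_coe, Metric.mem_closure_iff] at hg
  rw [Metric.tendsto_nhds]
  intro ε hε
  have hVnn : 0 ≤ |V| := abs_nonneg V
  -- Replacing g by f costs (|V| + 1)η in the averages and |V|η in the limit; with (2|V| + 2)η = ε /
  -- 2 there is room for the convergence of f.
  obtain ⟨f, hf, hfg⟩ := hg (ε / (2 * (2 * |V| + 2))) (by positivity)
  set η := ε / (2 * (2 * |V| + 2)) with hη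
  have hηpos : 0 < η := by positivity
  have hf' : Tendsto (fun Q => (∑ z ∈ P Q, f (θ z : UnitAddCircle)) / (s Q : ℂ)) atTop
        (𝓝 (V * ∫ x in (0 : ℝ)..1, f (x : UnitAddCircle))) := hspan hf
  have e1 := (Metric.tendsto_nhds.1 hf') (ε / 2) (by positivity)
  have e2 := (Metric.tendsto_nhds.1 hV) 1 one_pos
  have hpt : ∀ x, ‖g x - f x‖ ≤ η := fun x => by
    rw [← dist_eq_norm]; exact (ContinuousMap.dist_apply_le_dist x).trans hfg.le
  have hint : ‖(∫ x in (0 : ℝ)..1, f (x : UnitAddCircle)) -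
      ∫ x in (0 : ℝ)..1, g (x : UnitAddCircle)‖ ≤ η := by
    rw [← intervalIntegral.integral_sub ((continuous_coe_unitAddCircle f).intervalIntegrable _ _)
      ((continuous_coe_unitAddCircle g).intervalIntegrable _ _)]
    refine (intervalIntegral.norm_integral_le_of_norm_le_const (C := η) fun x _ => ?_).trans
      (by simp)
    rw [norm_sub_rev]; exact hpt _
  filter_upwards [hs, e1, e2] with Q hsQ h1 h2
  rw [dist_eq_norm] at h1 ⊢
  rw [Real.dist_eq] at h2
  have hN : ((P Q).card : ℝ) / s Q ≤ |V| + 1 := by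
    have := (abs_lt.1 h2).2
    have := le_abs_self V
    linarith
  have hdiff : ‖(∑ z ∈ P Q, g (θ z : UnitAddCircle)) / (s Q : ℂ) -
      (∑ z ∈ P Q, f (θ z : UnitAddCircle)) / (s Q : ℂ)‖ ≤ (|V| + 1) * η := by
    rw [← sub_div, ← Finset.sum_sub_distrib, norm_div, Complex.norm_of_nonneg hsQ.le,
      div_le_iff₀ hsQ]
    calc _ ≤ ∑ z ∈ P Q, η := (norm_sum_le _ _).trans (Finset.sum_le_sum fun z _ => hpt _)
      _ = (P Q).card / s Q * η * s Q := by
          rw [Finset.sum_const, nsmul_eq_mul]; field_simp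
      _ ≤ _ := by gcongr
  have hlast : ‖(V : ℂ) * (∫ x in (0 : ℝ)..1, f (x : UnitAddCircle)) -
      V * ∫ x in (0 : ℝ)..1, g (x : UnitAddCircle)‖ ≤ |V| * η := by
    rw [← mul_sub, norm_mul, Complex.norm_real, Real.norm_eq_abs]
    gcongr
  have hηε : (2 * |V| + 2) * η = ε / 2 := by rw [hη]; field_simp
  have tri := norm_add₃_le (a := (∑ z ∈ P Q, g (θ z : UnitAddCircle)) / (s Q : ℂ) -
      (∑ z ∈ P Q, f (θ z : UnitAddCircle)) / (s Q : ℂ))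
    (b := (∑ z ∈ P Q, f (θ z : UnitAddCircle)) / (s Q : ℂ) -
      V * ∫ x in (0 : ℝ)..1, f (x : UnitAddCircle))
    (c := (V : ℂ) * (∫ x in (0 : ℝ)..1, f (x : UnitAddCircle)) -
      V * ∫ x in (0 : ℝ)..1, g (x : UnitAddCircle))
  rw [sub_add_sub_cancel, sub_add_sub_cancel] at tri
  nlinarith

/-- Lower bound for the number of points in an open interval, from Weyl's criterion. -/
theorem eventually_lt_card_Ioo_of_weyl (hs : ∀ᶠ Q in atTop, 0 < s Q)
    (hθ : ∀ z, θ z ∈ Ico (0 : ℝ) 1)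
    (hV : Tendsto (fun Q => ((P Q).card : ℝ) / s Q) atTop (𝓝 V))
    (hW : ∀ k : ℤ, k ≠ 0 → Tendsto (fun Q => (∑ z ∈ P Q, fourier k ((θ z : ℝ) : UnitAddCircle)) /
      (s Q : ℂ)) atTop (𝓝 0)) {a b : ℝ} (ha : 0 ≤ a) (hab : a ≤ b) (hb : b ≤ 1)
    {c : ℝ} (hc : c < V * (b - a)) :
    ∀ᶠ Q in atTop, c < (((P Q).filter fun z => a < θ z ∧ θ z < b).card : ℝ) / s Q := by
  rcases hab.eq_or_lt with rfl | hab
  · filter_upwards [hs] with Q hQ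
    rw [sub_self, mul_zero] at hc
    exact hc.trans_le (by positivity)
  have hV0 : 0 ≤ V := ge_of_tendsto hV (by filter_upwards [hs] with Q hQ; positivity)
  obtain ⟨ε, hε, hεab, hcε⟩ : ∃ ε : ℝ, 0 < ε ∧ 2 * ε < b - a ∧ c < V * (b - a - 2 * ε) := by
    have h1 : Tendsto (fun ε : ℝ => V * (b - a - 2 * ε)) (𝓝[>] 0) (𝓝 (V * (b - a - 2 * 0))) :=
      Tendsto.mono_left (Continuous.tendsto (by fun_prop) 0) nhdsWithin_le_nhds
    rw [mul_zero, sub_zero] at h1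
    have h2 : ∀ᶠ ε : ℝ in 𝓝[>] 0, 2 * ε < b - a := by
      filter_upwards [Ioo_mem_nhdsGT (show (0 : ℝ) < (b - a) / 2 by linarith)] with ε hε
      linarith [hε.2]
    obtain ⟨ε, h3, h4, h5⟩ :=
      ((h1.eventually_const_lt hc).and (h2.and self_mem_nhdsWithin)).exists
    exact ⟨ε, h5, h4, h3⟩
  -- A trapezoid below the indicator of (a, b), equal to 1 on [a + ε, b - ε]. It vanishes at 0 and
  -- 1, so it descends to the circle.
  set T : ℝ → ℝ := fun x => min 1 (max 0 (min (x - a) (b - x) / ε)) with hT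
  have hTc : Continuous T := by fun_prop
  have hT0 : ∀ x, 0 ≤ T x := fun x => le_min zero_le_one (le_max_left _ _)
  have hT1 : ∀ x, T x ≤ 1 := fun x => min_le_left _ _
  have hTout : ∀ x, ¬ (a < x ∧ x < b) → T x = 0 := by
    intro x hx
    have : min (x - a) (b - x) ≤ 0 := by
      by_contra h
      rw [not_le, lt_min_iff] at h
      exact hx ⟨by linarith, by linarith⟩
    simp only [hT]
    rw [max_eq_left (div_nonpos_of_nonpos_of_nonneg this hε.le), min_eq_right zero_le_one]
  have hTin : ∀ x, a + ε ≤ x → x ≤ b - ε → T x = 1 := by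
    intro x h1 h2
    have : 1 ≤ min (x - a) (b - x) / ε := by
      rw [le_div_iff₀ hε, one_mul, le_min_iff]; constructor <;> linarith
    simp only [hT]
    rw [min_eq_left (this.trans (le_max_right _ _))]
  have hT01 : T 0 = T 1 := by
    rw [hTout 0 (by rintro ⟨h, _⟩; linarith), hTout 1 (by rintro ⟨_, h⟩; linarith)]
  let g : C(UnitAddCircle, ℂ) := ⟨fun x => ((AddCircle.liftIco 1 0 T x : ℝ) : ℂ),
    Complex.continuous_ofReal.comp (AddCircle.liftIco_zero_continuous hT01 hTc.continuousOn)⟩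
  have hg : ∀ x ∈ Ico (0 : ℝ) 1, g (x : UnitAddCircle) = (T x : ℂ) := fun x hx => by
    change ((AddCircle.liftIco 1 0 T (x : UnitAddCircle) : ℝ) : ℂ) = _
    rw [AddCircle.liftIco_zero_coe_apply hx]
  have hint : ∫ x in (0 : ℝ)..1, g (x : UnitAddCircle) = ((∫ x in (0 : ℝ)..1, T x : ℝ) : ℂ) := by
    rw [← intervalIntegral.integral_ofReal]
    refine intervalIntegral.integral_congr fun x hx => ?_
    rw [uIcc_of_le zero_le_one] at hx
    rcases hx.2.eq_or_lt with rfl | h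
    · have : ((1 : ℝ) : UnitAddCircle) = ((0 : ℝ) : UnitAddCircle) := by
        rw [AddCircle.coe_period, AddCircle.coe_zero]
      change g ((1 : ℝ) : UnitAddCircle) = (T 1 : ℂ)
      rw [this, hg 0 ⟨le_rfl, one_pos⟩, hT01]
    · exact hg x ⟨hx.1, h⟩
  have hintge : b - a - 2 * ε ≤ ∫ x in (0 : ℝ)..1, T x := by
    calc b - a - 2 * ε = ∫ x in (a + ε)..(b - ε), T x := by
          rw [intervalIntegral.integral_congr (g := fun _ => (1 : ℝ)) fun x hx => ?_]
          · simp; ring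
          · rw [uIcc_of_le (by linarith)] at hx
            exact hTin x hx.1 hx.2
      _ ≤ _ := intervalIntegral.integral_mono_interval (by linarith) (by linarith) (by linarith)
          (Eventually.of_forall hT0) (hTc.intervalIntegrable _ _)
  have hlim := tendsto_sum_continuous_of_weyl hs hV hW g
  rw [hint] at hlim
  have hre := (Complex.continuous_re.tendsto _).comp hlim
  rw [← Complex.ofReal_mul, Complex.ofReal_re] at hre
  have hlt : c < V * ∫ x in (0 : ℝ)..1, T x := hcε.trans_le (by gcongr)
  filter_upwards [hs, hre.eventually_const_lt hlt] with Q hsQ hQ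
  refine hQ.trans_le ?_
  have e : (∑ z ∈ P Q, g (θ z : UnitAddCircle)) / (s Q : ℂ) =
      (((∑ z ∈ P Q, T (θ z)) / s Q : ℝ) : ℂ) := by
    push_cast
    congr 1
    exact Finset.sum_congr rfl fun z _ => hg _ (hθ z)
  simp only [Function.comp_apply]
  rw [e, Complex.ofReal_re]
  gcongr
  rw [Finset.card_filter]
  push_cast
  refine Finset.sum_le_sum fun z _ => ?_
  split_ifs with h
  · exact hT1 _
  · exact (hTout _ h).le

/-- The upper bound comes from lower bounds: points of [a, b] avoid (0, a) and (b, 1), which already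
take nearly V(1 - (b - a)) of the total. The three tolerances δ / 4 add up to less than δ. -/
theorem tendsto_card_Icc_of_weyl (hs : ∀ᶠ Q in atTop, 0 < s Q)
    (hθ : ∀ z, θ z ∈ Ico (0 : ℝ) 1)
    (hV : Tendsto (fun Q => ((P Q).card : ℝ) / s Q) atTop (𝓝 V))
    (hW : ∀ k : ℤ, k ≠ 0 → Tendsto (fun Q => (∑ z ∈ P Q, fourier k ((θ z : ℝ) : UnitAddCircle)) /
      (s Q : ℂ)) atTop (𝓝 0)) {a b : ℝ} (ha : 0 ≤ a) (hab : a ≤ b) (hb : b ≤ 1) :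
    Tendsto (fun Q => (((P Q).filter fun z => θ z ∈ Icc a b).card : ℝ) / s Q) atTop
      (𝓝 (V * (b - a))) := by
  rw [tendsto_order]
  constructor
  · intro c hc
    filter_upwards [hs, eventually_lt_card_Ioo_of_weyl hs hθ hV hW ha hab hb hc] with Q hsQ hQ
    refine hQ.trans_le ?_
    gcongr with z
    exact fun h => ⟨h.1.le, h.2.le⟩
  · intro c hc
    set δ := c - V * (b - a) with hδ
    have hδ0 : 0 < δ := by linarith
    have h1 := eventually_lt_card_Ioo_of_weyl hs hθ hV hW le_rfl ha (hab.trans hb)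
      (c := V * (a - 0) - δ / 4) (by linarith)
    have h2 := eventually_lt_card_Ioo_of_weyl hs hθ hV hW (ha.trans hab) hb le_rfl
      (c := V * (1 - b) - δ / 4) (by linarith)
    filter_upwards [hs, h1, h2, hV.eventually_lt_const (show V < V + δ / 4 by linarith)]
      with Q hsQ hQ1 hQ2 hQ3
    have hcard : (((P Q).filter fun z => θ z ∈ Icc a b).card : ℝ) +
        ((P Q).filter fun z => 0 < θ z ∧ θ z < a).card +
        ((P Q).filter fun z => b < θ z ∧ θ z < 1).card ≤ (P Q).card := by
      rw [Finset.card_filter, Finset.card_filter, Finset.card_filter,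
        Finset.card_eq_sum_ones (P Q)]
      push_cast
      rw [← Finset.sum_add_distrib, ← Finset.sum_add_distrib]
      refine Finset.sum_le_sum fun z _ => ?_
      by_cases hA : θ z ∈ Icc a b
      · rw [if_pos hA, if_neg fun h => absurd hA.1 (not_le.2 h.2),
          if_neg fun h => absurd hA.2 (not_le.2 h.1)]
        norm_num
      · rw [if_neg hA]
        by_cases hB : 0 < θ z ∧ θ z < a
        · rw [if_pos hB, if_neg fun h => by linarith [hB.2, h.1]]; norm_num
        · rw [if_neg hB]; split_ifs <;> norm_num
    have hdiv := div_le_div_of_nonneg_right hcard hsQ.le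
    rw [add_div, add_div] at hdiv
    linarith

end Weyl

/-! ### Equidistribution of neighbouring denominators -/

/-- The half-plane containing the pairs of neighbouring denominators. -/
def fareyHalfPlane : Set (ℝ × ℝ) := {z | 1 < z.1 + z.2}

theorem volume_eq_zero_of_sections {S : Set (ℝ × ℝ)} (hS : MeasurableSet S)
    (h : ∀ x, {y | (x, y) ∈ S}.Finite) : volume S = 0 := by
  rw [Measure.volume_eq_prod, Measure.measure_prod_null hS]
  exact Eventually.of_forall fun x => (h x).measure_zero volume

theorem measurableSet_fareyHalfPlane : MeasurableSet fareyHalfPlane :=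
  measurableSet_lt measurable_const (by fun_prop)

theorem frontier_fareyHalfPlane_compl : volume (frontier fareyHalfPlaneᶜ) = 0 := by
  have h1 : frontier fareyHalfPlaneᶜ ⊆ {z : ℝ × ℝ | z.1 + z.2 = 1} := by
    have : fareyHalfPlaneᶜ = {z : ℝ × ℝ | z.1 + z.2 ≤ 1} := by
      ext z; simp [fareyHalfPlane]
    rw [this]
    exact frontier_le_subset_eq (by fun_prop) continuous_const
  refine measure_mono_null h1 (volume_eq_zero_of_sections ?_ fun x => ?_)
  · exact measurableSet_eq_fun (by fun_prop) measurable_const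
  · refine (Set.finite_singleton (1 - x)).subset fun y hy => ?_
    simp only [Set.mem_ofPred_eq] at hy
    simp only [mem_singleton_iff]; linarith

/-- The half-plane x + y > 1 is not star-shaped about the origin, but its complement within the
positive quadrant is; counts in the half-plane are obtained by subtraction. -/
theorem IsStarRegion.inter_compl {A : Set (ℝ × ℝ)} (hA : IsStarRegion A) :
    IsStarRegion (A ∩ fareyHalfPlaneᶜ) where
  subset := inter_subset_left.trans hA.subset
  measurableSet := hA.measurableSet.inter measurableSet_fareyHalfPlane.compl
  frontier := by
    refine measure_mono_null (frontier_inter_subset _ _) (measure_union_null ?_ ?_)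
    · exact measure_mono_null inter_subset_left hA.frontier
    · exact measure_mono_null inter_subset_right frontier_fareyHalfPlane_compl
  star := by
    rintro r h0 h1 z ⟨hz, hz'⟩
    refine ⟨hA.star r h0 h1 z hz, ?_⟩
    have hs := hA.subset hz
    simp only [fareyHalfPlane, mem_compl_iff, Set.mem_ofPred_eq, not_lt, Prod.smul_fst,
      Prod.smul_snd, smul_eq_mul] at hz' ⊢
    nlinarith [hs.1.1, hs.2.1]

theorem card_coprimePairs_inter (A : Set (ℝ × ℝ)) (H : Set (ℝ × ℝ)) (Q : ℕ) :
    (coprimePairs (A ∩ H) Q).card + (coprimePairs (A ∩ Hᶜ) Q).card = (coprimePairs A Q).card := by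
  classical
  rw [← Finset.card_union_of_disjoint]
  · congr 1
    ext z
    simp only [coprimePairs, latticePoints, Finset.mem_union, Finset.mem_filter, mem_inter_iff,
      mem_compl_iff]
    tauto
  · rw [Finset.disjoint_left]
    intro z h1 h2
    simp only [coprimePairs, latticePoints, Finset.mem_filter, mem_inter_iff,
      mem_compl_iff] at h1 h2
    exact h2.1.2.2 h1.1.2.2

theorem volume_ne_top_of_subset_unitSquare {A : Set (ℝ × ℝ)} (hA : A ⊆ Ioc 0 1 ×ˢ Ioc 0 1) :
    volume A ≠ ⊤ := by
  refine ne_top_of_le_ne_top ?_ (measure_mono hA)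
  rw [Measure.volume_eq_prod, Measure.prod_prod]
  simp

theorem IsStarRegion.tendsto_card_coprimePairs_halfPlane {A : Set (ℝ × ℝ)} (hA : IsStarRegion A) :
    Tendsto (fun Q : ℕ => ((coprimePairs (A ∩ fareyHalfPlane) Q).card : ℝ) / (Q : ℝ) ^ 2) atTop
      (𝓝 (coprimeDensity * volume.real (A ∩ fareyHalfPlane))) := by
  have h := hA.tendsto_card_coprimePairs.sub hA.inter_compl.tendsto_card_coprimePairs
  have hv : volume.real A = volume.real (A ∩ fareyHalfPlane) +
      volume.real (A ∩ fareyHalfPlaneᶜ) := by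
    rw [← sdiff_eq, measureReal_inter_add_sdiff measurableSet_fareyHalfPlane
      (volume_ne_top_of_subset_unitSquare hA.subset)]
  rw [← mul_sub, hv, add_sub_cancel_right] at h
  refine h.congr fun Q => ?_
  rw [← sub_div, ← card_coprimePairs_inter A fareyHalfPlane Q]
  push_cast; ring

/-- Puts the admissible n in the form that completion requires. -/
theorem exists_eq_Ico {J : Finset ℕ} {m q : ℕ} (hJ : J ⊆ Finset.Ioc m (m + q))
    (hconn : ∀ x ∈ J, ∀ y ∈ J, ∀ z, x ≤ z → z ≤ y → z ∈ J) :
    ∃ a b, b ≤ a + q ∧ J = Finset.Ico a b := by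
  rcases J.eq_empty_or_nonempty with rfl | hne
  · exact ⟨0, 0, by simp, by simp⟩
  · refine ⟨J.min' hne, J.max' hne + 1, ?_, ?_⟩
    · have h1 := Finset.mem_Ioc.1 (hJ (J.min'_mem hne))
      have h2 := Finset.mem_Ioc.1 (hJ (J.max'_mem hne))
      omega
    · ext z
      rw [Finset.mem_Ico, Nat.lt_succ_iff]
      exact ⟨fun h => ⟨J.min'_le z h, J.le_max' z h⟩,
        fun h => hconn _ (J.min'_mem hne) _ (J.max'_mem hne) z h.1 h.2⟩

theorem leftFraction_mem_Ico (q n : ℕ) : leftFraction q n ∈ Ico (0 : ℝ) 1 := by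
  rcases Nat.eq_zero_or_pos q with rfl | hq
  · simp [leftFraction]
  · have : NeZero q := ⟨hq.ne'⟩
    refine ⟨by unfold leftFraction; positivity, ?_⟩
    rw [leftFraction, div_lt_one (by exact_mod_cast hq)]
    exact_mod_cast ZMod.val_lt _

open Classical in
/-- Pairs of neighbouring denominators lying in a dilated region, with the corresponding fraction
in `[α, β]`. -/
noncomputable def neighbourPairs (A : Set (ℝ × ℝ)) (α β : ℝ) (Q : ℕ) : Finset (ℕ × ℕ) :=
  (coprimePairs (A ∩ fareyHalfPlane) Q).filter fun z => leftFraction z.1 z.2 ∈ Icc α β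

/-- Weyl's criterion applied to `leftFraction`. For fixed q the section of A is order-connected, and
q + n > Q forces n into (Q - q, Q]; so n runs over an interval of at most q integers, and the Weyl
sums are incomplete Kloosterman sums. -/
theorem IsStarRegion.tendsto_card_neighbourPairs {A : Set (ℝ × ℝ)} (hA : IsStarRegion A)
    (hsec : ∀ x, OrdConnected {y | (x, y) ∈ A}) {α β : ℝ} (hα : 0 ≤ α) (hαβ : α ≤ β) (hβ : β ≤ 1) :
    Tendsto (fun Q : ℕ => ((neighbourPairs A α β Q).card : ℝ) / (Q : ℝ) ^ 2) atTop
      (𝓝 (coprimeDensity * volume.real (A ∩ fareyHalfPlane) * (β - α))) := by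
  classical
  have hmain := tendsto_card_Icc_of_weyl (P := fun Q => coprimePairs (A ∩ fareyHalfPlane) Q)
    (θ := fun z => leftFraction z.1 z.2) (s := fun Q => (Q : ℝ) ^ 2)
    (by filter_upwards [eventually_gt_atTop 0] with Q hQ; positivity)
    (fun z => leftFraction_mem_Ico _ _) hA.tendsto_card_coprimePairs_halfPlane ?_ hα hαβ hβ
  · refine hmain.congr fun Q => ?_
    congr 2
  · intro k hk
    let J : ℕ → ℕ → Finset ℕ := fun Q q => (Finset.Ioc 0 Q).filter fun n =>
      ((q : ℝ) / Q, (n : ℝ) / Q) ∈ A ∩ fareyHalfPlane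
    have hJ : ∀ Q q, 0 < q → q ≤ Q → ∃ a b, b ≤ a + q ∧ J Q q = Finset.Ico a b := by
      intro Q q hq hqQ
      have hQ : (0 : ℝ) < Q := by exact_mod_cast hq.trans_le hqQ
      refine exists_eq_Ico (m := Q - q) ?_ ?_
      · intro n hn
        simp only [J, Finset.mem_filter, Finset.mem_Ioc, mem_inter_iff, fareyHalfPlane,
          Set.mem_ofPred_eq] at hn
        have h1 := hn.2.2
        rw [← add_div, lt_div_iff₀ hQ, one_mul] at h1
        have h2 : Q < q + n := by exact_mod_cast h1
        rw [Finset.mem_Ioc]; omega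
      · intro x hx y hy z hxz hzy
        simp only [J, Finset.mem_filter, Finset.mem_Ioc, mem_inter_iff, fareyHalfPlane,
          Set.mem_ofPred_eq] at hx hy ⊢
        have e1 : (x : ℝ) / Q ≤ z / Q := by gcongr
        have e2 : (z : ℝ) / Q ≤ y / Q := by gcongr
        refine ⟨by omega, (hsec _).out hx.2.1 hy.2.1 ⟨e1, e2⟩, ?_⟩
        linarith [hx.2.2]
    refine (tendsto_sum_fourier_leftFraction hk J hJ).congr fun Q => ?_
    push_cast
    congr 1
    rw [Finset.sum_sigma']
    refine Finset.sum_bij' (fun z _ => (z.1, z.2)) (fun z _ => ⟨z.1, z.2⟩) ?_ ?_ ?_ ?_ ?_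
    · rintro ⟨q, n⟩ h
      simp only [J, coprimePairs, latticePoints, Finset.mem_sigma, Finset.mem_filter,
        Finset.mem_product, Nat.floor_natCast] at h ⊢
      tauto
    · rintro ⟨q, n⟩ h
      simp only [J, coprimePairs, latticePoints, Finset.mem_sigma, Finset.mem_filter,
        Finset.mem_product, Nat.floor_natCast] at h ⊢
      tauto
    · intros; rfl
    · intros; rfl
    · intros; rfl


/-! ### Farey neighbours and their denominators -/

/-- With determinant 1, `u.den` is a combination of `s.den` and `r.den` whose coefficients are the
cross-differences of (r, u) and (u, s), both positive integers. -/
theorem den_add_den_le_of_between {r s u : ℚ} (h : s.num * r.den - r.num * s.den = 1)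
    (hru : r < u) (hus : u < s) : r.den + s.den ≤ u.den := by
  rw [Rat.lt_iff] at hru hus
  have hr : (0 : ℤ) < r.den := by exact_mod_cast r.pos
  have hs : (0 : ℤ) < s.den := by exact_mod_cast s.pos
  have e : (u.den : ℤ) = s.den * (u.num * r.den - r.num * u.den) +
      r.den * (s.num * u.den - u.num * s.den) := by
    linear_combination (-(u.den : ℤ)) * h
  have : (r.den + s.den : ℤ) ≤ u.den := by nlinarith
  exact_mod_cast this

theorem leftFraction_eq {r : ℚ} {n : ℕ} (hr0 : 0 ≤ r) (hr1 : r < 1)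
    (h : (r.den : ℤ) ∣ r.num * n + 1) : leftFraction r.den n = r := by
  have : NeZero r.den := ⟨r.den_nz⟩
  have hnum : 0 ≤ r.num := Rat.num_nonneg.2 hr0
  have hlt : r.num < r.den := Rat.num_lt_denom_iff.2 hr1
  have h0 : (r.num : ZMod r.den) * n = -1 := by
    have := (ZMod.intCast_zmod_eq_zero_iff_dvd _ _).2 h
    push_cast at this
    linear_combination this
  have hinv : (r.num : ZMod r.den) = -(n : ZMod r.den)⁻¹ := by
    have hu : IsUnit (n : ZMod r.den) := IsUnit.of_mul_eq_one (-(r.num : ZMod r.den))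
      (by linear_combination -h0)
    have := ZMod.mul_inv_of_unit _ hu
    linear_combination (n : ZMod r.den)⁻¹ * h0 - (r.num : ZMod r.den) * this
  have hval : (((r.num : ZMod r.den)).val : ℤ) = r.num := by
    rw [ZMod.val_intCast, Int.emod_eq_of_lt hnum hlt]
  rw [leftFraction, ← hinv]
  conv_rhs => rw [← Rat.num_div_den r]
  push_cast
  congr 1
  exact_mod_cast hval

theorem exists_leftFraction {q n : ℕ} (hq : 0 < q) (h : Nat.Coprime n q) :
    ∃ r : ℚ, r.den = q ∧ 0 ≤ r ∧ r < 1 ∧ (r.den : ℤ) ∣ r.num * n + 1 := by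
  have : NeZero q := ⟨hq.ne'⟩
  set p : ℕ := (-(n : ZMod q)⁻¹ : ZMod q).val with hp
  have hdvd : (q : ℤ) ∣ (p : ℤ) * n + 1 := by
    rw [← ZMod.intCast_zmod_eq_zero_iff_dvd]
    push_cast
    rw [hp, ZMod.natCast_zmod_val]
    have := ZMod.coe_mul_inv_eq_one n h
    linear_combination -this
  have hco : Nat.Coprime p q := by
    obtain ⟨c, hc⟩ := hdvd
    rw [← Nat.isCoprime_iff_coprime]
    exact ⟨-n, c, by linear_combination -hc⟩
  have hden : (((p : ℤ) / (q : ℤ) : ℚ).den : ℤ) = q :=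
    Rat.den_div_eq_of_coprime (by exact_mod_cast hq) (by simpa using hco)
  have hnum : ((p : ℤ) / (q : ℤ) : ℚ).num = p :=
    Rat.num_div_eq_of_coprime (by exact_mod_cast hq) (by simpa using hco)
  refine ⟨((p : ℤ) / (q : ℤ) : ℚ), by exact_mod_cast hden, by positivity, ?_, ?_⟩
  · rw [div_lt_one (by exact_mod_cast hq)]
    exact_mod_cast ZMod.val_lt _
  · rw [hden, hnum]; exact hdvd

theorem exists_right_neighbour {r : ℚ} {n : ℕ} (hn : 0 < n) (hr1 : r < 1)
    (h : (r.den : ℤ) ∣ r.num * n + 1) :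
    ∃ s : ℚ, s.den = n ∧ s.num * r.den - r.num * s.den = 1 ∧ r < s ∧ s ≤ 1 := by
  obtain ⟨c, hc⟩ := h
  have hco : Nat.Coprime c.natAbs n := by
    have h1 : IsCoprime c (n : ℤ) := ⟨r.den, -r.num, by linear_combination -hc⟩
    simpa [Int.isCoprime_iff_gcd_eq_one, Int.gcd, Nat.Coprime] using h1
  have hden : ((c / (n : ℤ) : ℚ).den : ℤ) = n :=
    Rat.den_div_eq_of_coprime (by exact_mod_cast hn) (by simpa using hco)
  have hnum : (c / (n : ℤ) : ℚ).num = c :=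
    Rat.num_div_eq_of_coprime (by exact_mod_cast hn) (by simpa using hco)
  have h1 : (c / (n : ℤ) : ℚ).num * r.den - r.num * (c / (n : ℤ) : ℚ).den = 1 := by
    rw [hden, hnum]; linear_combination -hc
  refine ⟨(c / (n : ℤ) : ℚ), by exact_mod_cast hden, h1, ?_, ?_⟩
  · rw [Rat.lt_iff]; linarith
  · have hlt : r.num < r.den := Rat.num_lt_denom_iff.2 hr1
    rw [div_le_one (by exact_mod_cast hn)]
    have hr : (0 : ℤ) < r.den := by exact_mod_cast r.pos
    have hn' : (0 : ℤ) < n := by exact_mod_cast hn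
    have : c ≤ n := by
      by_contra hcon
      rw [not_le] at hcon
      nlinarith
    exact_mod_cast this

/-- The solutions n of the congruence form one residue class modulo `r.den`, which meets (Q - r.den,
Q]. From a Bézout relation with coefficient u of the numerator, the representative is Q - ((Q + u)
mod r.den). -/
theorem exists_right_denominator {r : ℚ} {Q : ℕ} (hQ : r.den ≤ Q) :
    ∃ n : ℕ, 0 < n ∧ n ≤ Q ∧ Q < r.den + n ∧ Nat.Coprime n r.den ∧
      (r.den : ℤ) ∣ r.num * n + 1 := by
  have hr : (0 : ℤ) < r.den := by exact_mod_cast r.pos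
  obtain ⟨u, v, huv⟩ : IsCoprime r.num (r.den : ℤ) := by
    rw [Int.isCoprime_iff_gcd_eq_one]; exact r.reduced
  set m : ℤ := (Q + u) % r.den with hm
  have hm0 : 0 ≤ m := Int.emod_nonneg _ hr.ne'
  have hm1 : m < r.den := Int.emod_lt_of_pos _ hr
  have hm2 : (Q + u : ℤ) = r.den * ((Q + u) / r.den) + m := (Int.mul_ediv_add_emod _ _).symm
  obtain ⟨n, hn⟩ : ∃ n : ℕ, (n : ℤ) = Q - m := ⟨(Q - m).toNat, by
    rw [Int.toNat_of_nonneg]; have : (r.den : ℤ) ≤ Q := by exact_mod_cast hQ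
    linarith⟩
  have hd : (r.den : ℤ) ∣ r.num * n + 1 :=
    ⟨r.num * ((Q + u) / r.den) + v, by rw [hn]; linear_combination -huv + r.num * hm2⟩
  have hQ' : (r.den : ℤ) ≤ Q := by exact_mod_cast hQ
  refine ⟨n, ?_, ?_, ?_, ?_, hd⟩
  · have : (0 : ℤ) < n := by linarith
    exact_mod_cast this
  · have : (n : ℤ) ≤ Q := by linarith
    exact_mod_cast this
  · have : (Q : ℤ) < r.den + n := by linarith
    exact_mod_cast this
  · obtain ⟨c, hc⟩ := hd
    rw [← Nat.isCoprime_iff_coprime]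
    exact ⟨-r.num, c, by linear_combination -hc⟩

/-- Neighbours in a Farey sequence restricted to an interval. -/
theorem consecutivePairs_det {α β : ℝ} {Q : ℕ} {z : ℚ × ℚ} (hz : z ∈ consecutivePairs α β Q) :
    z.2.num * z.1.den - z.1.num * z.2.den = 1 ∧ Q < z.1.den + z.2.den := by
  obtain ⟨⟨h10, h11, h1Q, h1I⟩, ⟨h20, h21, h2Q, h2I⟩, hlt, hno⟩ := hz
  obtain ⟨n, hn0, hnQ, hnQ', hco, hd⟩ := exists_right_denominator h1Q
  obtain ⟨s, hsd, hdet, hrs, hs1⟩ := exists_right_neighbour hn0 (hlt.trans_le h21) hd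
  have hs : s = z.2 := by
    -- If `s < z.2`, then s would be a Farey point between consecutive ones; if `z.2 < s`, the
    -- denominator of `z.2` would exceed Q.
    rcases lt_trichotomy s z.2 with h | h | h
    · refine absurd ⟨hrs, h⟩ (hno s ⟨h10.trans hrs.le, hs1, by omega, ?_, ?_⟩)
      · exact h1I.1.trans (by exact_mod_cast hrs.le)
      · exact le_trans (by exact_mod_cast h.le) h2I.2
    · exact h
    · have := den_add_den_le_of_between hdet hlt h
      omega
  rw [← hs]
  exact ⟨hdet, by omega⟩

theorem mem_neighbourPairs {A : Set (ℝ × ℝ)} {α β : ℝ} {Q : ℕ}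
    (hQ : 0 < Q) {z : ℕ × ℕ} : z ∈ neighbourPairs A α β Q ↔
      ((z.1 : ℝ) / Q, (z.2 : ℝ) / Q) ∈ A ∧ 0 < z.1 ∧ 0 < z.2 ∧ z.1 ≤ Q ∧ z.2 ≤ Q ∧
      Q < z.1 + z.2 ∧ Nat.Coprime z.2 z.1 ∧ leftFraction z.1 z.2 ∈ Icc α β := by
  have hQ' : (0 : ℝ) < Q := by exact_mod_cast hQ
  have e : (1 : ℝ) < z.1 / Q + z.2 / Q ↔ Q < z.1 + z.2 := by
    rw [← add_div, lt_div_iff₀ hQ', one_mul]; exact_mod_cast Iff.rfl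
  simp only [neighbourPairs, coprimePairs, latticePoints, Finset.mem_filter, Finset.mem_product,
    Finset.mem_Ioc, Nat.floor_natCast, mem_inter_iff]
  simp only [fareyHalfPlane, Set.mem_ofPred_eq, e]
  tauto

/-- The Farey fractions attached to a pair of neighbouring denominators. -/
theorem exists_of_mem_neighbourPairs {A : Set (ℝ × ℝ)} {α β : ℝ}
    {Q : ℕ} (hQ : 0 < Q) {z : ℕ × ℕ} (hz : z ∈ neighbourPairs A α β Q) :
    ∃ r s : ℚ, r.den = z.1 ∧ s.den = z.2 ∧ s.num * r.den - r.num * s.den = 1 ∧ r < s ∧ s ≤ 1 ∧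
      r ∈ fareyPoints α β Q ∧ (r : ℝ) = leftFraction z.1 z.2 := by
  obtain ⟨hzA, h1, h2, h1Q, h2Q, hsum, hco, hI⟩ := (mem_neighbourPairs hQ).1 hz
  obtain ⟨r, hrd, hr0, hr1, hd⟩ := exists_leftFraction h1 hco
  obtain ⟨s, hsd, hdet, hrs, hs1⟩ := exists_right_neighbour h2 hr1 hd
  have hl := leftFraction_eq hr0 hr1 hd
  rw [hrd] at hl
  exact ⟨r, s, hrd, hsd, hdet, hrs, hs1, ⟨hr0, hr1.le, by omega, hl ▸ hI⟩, hl.symm⟩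

/-- If they differed, the smaller would lie strictly between r and the larger, so its denominator
would exceed Q. -/
theorem right_unique {Q : ℕ} {r s s' : ℚ} (h : s.num * r.den - r.num * s.den = 1)
    (h' : s'.num * r.den - r.num * s'.den = 1) (hQ : Q < r.den + s.den) (hQ' : Q < r.den + s'.den)
    (hs : s.den ≤ Q) (hs' : s'.den ≤ Q) (hrs : r < s) (hrs' : r < s') : s = s' := by
  rcases lt_trichotomy s s' with hlt | heq | hlt
  · have := den_add_den_le_of_between h' hrs hlt; omega
  · exact heq
  · have := den_add_den_le_of_between h hrs' hlt; omega

/-- Passing to denominators loses nothing: `leftFraction` recovers the left fraction, and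
`right_unique` then recovers the right one. -/
theorem ncard_consecutivePairs_le {A : Set (ℝ × ℝ)} {α β : ℝ}
    {Q : ℕ} (hQ : 0 < Q) :
    {z ∈ consecutivePairs α β Q | ((z.1.den : ℝ) / Q, (z.2.den : ℝ) / Q) ∈ A}.ncard ≤
      (neighbourPairs A α β Q).card := by
  rw [← Set.ncard_coe_finset]
  have hinfo : ∀ z ∈ consecutivePairs α β Q, leftFraction z.1.den z.2.den = z.1 := by
    intro z hz
    have hdet := (consecutivePairs_det hz).1
    exact leftFraction_eq hz.1.1 (hz.2.2.1.trans_le hz.2.1.2.1)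
      ⟨z.2.num, by linear_combination -hdet⟩
  refine Set.ncard_le_ncard_of_injOn (fun z => (z.1.den, z.2.den)) ?_ ?_ (Finset.finite_toSet _)
  · rintro z ⟨hz, hzA⟩
    obtain ⟨hdet, hsum⟩ := consecutivePairs_det hz
    rw [Finset.mem_coe, mem_neighbourPairs hQ]
    refine ⟨hzA, z.1.pos, z.2.pos, hz.1.2.2.1, hz.2.1.2.2.1, hsum, ?_, ?_⟩
    · rw [← Nat.isCoprime_iff_coprime]
      exact ⟨-z.1.num, z.2.num, by linear_combination hdet⟩
    · simp only
      rw [hinfo z hz]; exact hz.1.2.2.2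
  · rintro z ⟨hz, -⟩ w ⟨hw, -⟩ h
    simp only [Prod.mk.injEq] at h
    have h1 : z.1 = w.1 := by
      have := hinfo z hz
      rw [h.1, h.2, hinfo w hw] at this
      exact_mod_cast this.symm
    obtain ⟨hd, hs⟩ := consecutivePairs_det hz
    obtain ⟨hd', hs'⟩ := consecutivePairs_det hw
    rw [← h1] at hd' hs'
    exact Prod.ext h1 (right_unique hd hd' hs hs' hz.2.1.2.2.1 hw.2.1.2.2.1 hz.2.2.1
      (h1 ▸ hw.2.2.1))

/-- A missed pair has its left fraction in [α, β] and its right fraction beyond β. Two distinct left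
fractions of this kind would put one inside the gap of the other, impossible for denominators at
most Q; hence the single extra unit. -/
theorem card_neighbourPairs_le {A : Set (ℝ × ℝ)} {α β : ℝ}
    {Q : ℕ} (hQ : 0 < Q) :
    (neighbourPairs A α β Q).card ≤
      {z ∈ consecutivePairs α β Q | ((z.1.den : ℝ) / Q, (z.2.den : ℝ) / Q) ∈ A}.ncard + 1 := by
  classical
  set X := {z ∈ consecutivePairs α β Q | ((z.1.den : ℝ) / Q, (z.2.den : ℝ) / Q) ∈ A} with hX
  have hXfin : X.Finite := by
    refine ((fareyPoints_finite α β Q).prod (fareyPoints_finite α β Q)).subset ?_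
    rintro z ⟨hz, -⟩
    exact ⟨hz.1, hz.2.1⟩
  set I := (fun z : ℚ × ℚ => (z.1.den, z.2.den)) '' X with hI
  have hIfin : I.Finite := hXfin.image _
  have hIle : I.ncard ≤ X.ncard := Set.ncard_image_le hXfin
  have hone : ((neighbourPairs A α β Q : Set (ℕ × ℕ)) \ I).ncard ≤ 1 := by
    have hin : ∀ z ∈ (neighbourPairs A α β Q : Set (ℕ × ℕ)) \ I, ∃ r s : ℚ, r.den = z.1 ∧
        s.den = z.2 ∧ s.num * r.den - r.num * s.den = 1 ∧ r < s ∧ (r : ℝ) ≤ β ∧ β < s ∧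
        r.den ≤ Q ∧ s.den ≤ Q ∧ Q < r.den + s.den := by
      rintro z ⟨hz, hzI⟩
      rw [Finset.mem_coe] at hz
      obtain ⟨hzA, h1, h2, h1Q, h2Q, hsum, hco, hzI'⟩ := (mem_neighbourPairs hQ).1 hz
      obtain ⟨r, s, hr, hs, hdet, hrs, hs1, hrF, hl⟩ := exists_of_mem_neighbourPairs hQ hz
      refine ⟨r, s, hr, hs, hdet, hrs, hrF.2.2.2.2, ?_, by omega, by omega, by omega⟩
      by_contra hcon
      rw [not_lt] at hcon
      refine hzI ⟨(r, s), ⟨⟨hrF, ⟨hrF.1.trans hrs.le, hs1, hs.trans_le h2Q, ?_, hcon⟩, hrs, ?_⟩, ?_⟩, ?_⟩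
      · exact hrF.2.2.2.1.trans (by exact_mod_cast hrs.le)
      · rintro u hu ⟨hru, hus⟩
        have := den_add_den_le_of_between hdet hru hus
        have := hu.2.2.1
        omega
      · simp only [hr, hs]; exact hzA
      · simp [hr, hs]
    rw [Set.ncard_le_one ((Finset.finite_toSet _).sdiff)]
    intro z hz w hw
    obtain ⟨r, s, hr, hs, hdet, hrs, hrβ, hβs, hrQ, hsQ, hsum⟩ := hin z hz
    obtain ⟨r', s', hr', hs', hdet', hrs', hrβ', hβs', hrQ', hsQ', hsum'⟩ := hin w hw
    have hrr : r = r' := by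
      rcases lt_trichotomy r r' with h | h | h
      · have : r' < s := by exact_mod_cast hrβ'.trans_lt hβs
        have := den_add_den_le_of_between hdet h this; omega
      · exact h
      · have : r < s' := by exact_mod_cast hrβ.trans_lt hβs'
        have := den_add_den_le_of_between hdet' h this; omega
    subst hrr
    have := right_unique hdet hdet' hsum hsum' hsQ hsQ' hrs hrs'
    exact Prod.ext (hr.symm.trans hr') (hs.symm.trans (this ▸ hs'))
  have h1 := Set.ncard_le_ncard_sdiff_add_ncard (neighbourPairs A α β Q : Set (ℕ × ℕ)) I hIfin
  rw [Set.ncard_coe_finset] at h1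
  omega

theorem card_neighbourPairs_le_ncard_fareyPoints {α β : ℝ} {Q : ℕ} (hQ : 0 < Q) :
    (neighbourPairs (Ioc 0 1 ×ˢ Ioc 0 1) α β Q).card ≤ (fareyPoints α β Q).ncard := by
  rw [← Set.ncard_coe_finset]
  have hex := fun z (hz : z ∈ neighbourPairs (Ioc 0 1 ×ˢ Ioc 0 1) α β Q) =>
    exists_of_mem_neighbourPairs hQ hz
  choose! f g hf hg hdet hlt hle hmem hl using hex
  refine Set.ncard_le_ncard_of_injOn f (fun z hz => hmem z hz) ?_ (fareyPoints_finite α β Q)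
  intro z hz w hw h
  rw [Finset.mem_coe] at hz hw
  obtain ⟨-, -, -, -, h2Q, hsum, -⟩ := (mem_neighbourPairs hQ).1 hz
  obtain ⟨-, -, -, -, h2Q', hsum', -⟩ := (mem_neighbourPairs hQ).1 hw
  rw [← hf z hz, ← hg z hz] at hsum
  rw [← hf w hw, ← hg w hw] at hsum'
  have hd' := hdet w hw
  rw [← h] at hd' hsum'
  have := right_unique (hdet z hz) hd' hsum hsum' (by rw [hg z hz]; exact h2Q)
    (by rw [hg w hw]; exact h2Q') (hlt z hz) (h ▸ hlt w hw)
  exact Prod.ext (by rw [← hf z hz, h, hf w hw]) (by rw [← hg z hz, this, hg w hw])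

/-- Every fraction except 1 is the left end of a pair. The extra unit is for the fraction 1, as
`leftFraction` takes values in [0, 1). -/
theorem ncard_fareyPoints_le {α β : ℝ} {Q : ℕ} (hQ : 0 < Q) :
    (fareyPoints α β Q).ncard ≤ (neighbourPairs (Ioc 0 1 ×ˢ Ioc 0 1) α β Q).card + 1 := by
  have hQ' : (0 : ℝ) < Q := by exact_mod_cast hQ
  have h1 := Set.ncard_le_ncard_sdiff_add_ncard (fareyPoints α β Q) {1} (Set.finite_singleton _)
  rw [Set.ncard_singleton] at h1
  refine h1.trans (Nat.add_le_add_right ?_ 1)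
  rw [← Set.ncard_coe_finset]
  have hex : ∀ r ∈ fareyPoints α β Q, ∃ n : ℕ, 0 < n ∧ n ≤ Q ∧ Q < r.den + n ∧
      Nat.Coprime n r.den ∧ (r.den : ℤ) ∣ r.num * n + 1 :=
    fun r hr => exists_right_denominator hr.2.2.1
  choose! f h0 hfQ hsum hco hd using hex
  have hl : ∀ r ∈ fareyPoints α β Q \ {1}, leftFraction r.den (f r) = r := fun r hr =>
    leftFraction_eq hr.1.1 (lt_of_le_of_ne hr.1.2.1 hr.2) (hd r hr.1)
  refine Set.ncard_le_ncard_of_injOn (fun r => (r.den, f r)) ?_ ?_ (Finset.finite_toSet _)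
  · intro r hr
    rw [Finset.mem_coe, mem_neighbourPairs hQ]
    have hrQ := hr.1.2.2.1
    have hp := r.pos
    have hfp := h0 r hr.1
    have hfq := hfQ r hr.1
    refine ⟨⟨⟨by positivity, ?_⟩, ⟨by positivity, ?_⟩⟩, hp, hfp, hrQ, hfq, hsum r hr.1,
      hco r hr.1, ?_⟩
    · rw [div_le_one hQ']; exact_mod_cast hrQ
    · rw [div_le_one hQ']; exact_mod_cast hfq
    · simp only
      rw [hl r hr]; exact hr.1.2.2.2
  · intro r hr r' hr' h
    simp only [Prod.mk.injEq] at h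
    have := hl r hr
    rw [h.1, h.2, hl r' hr'] at this
    exact_mod_cast this.symm

/-! ### Equidistribution for level regions -/

/-- The half-open unit square. -/
def unitSquare : Set (ℝ × ℝ) := Ioc 0 1 ×ˢ Ioc 0 1

/-- The Farey triangle. -/
def fareyTriangle : Set (ℝ × ℝ) := unitSquare ∩ fareyHalfPlane

theorem mem_fareyTriangle {z : ℝ × ℝ} : z ∈ fareyTriangle ↔
    ((0 < z.1 ∧ z.1 ≤ 1) ∧ 0 < z.2 ∧ z.2 ≤ 1) ∧ 1 < z.1 + z.2 := Iff.rfl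

theorem measurableSet_unitSquare : MeasurableSet unitSquare :=
  measurableSet_Ioc.prod measurableSet_Ioc

theorem measurableSet_fareyTriangle : MeasurableSet fareyTriangle :=
  measurableSet_unitSquare.inter measurableSet_fareyHalfPlane

theorem volume_ne_top_of_subset_fareyTriangle {S : Set (ℝ × ℝ)} (hS : S ⊆ fareyTriangle) :
    volume S ≠ ⊤ :=
  volume_ne_top_of_subset_unitSquare (hS.trans inter_subset_left)

/-- The pairs of neighbouring denominators in `A`, normalised by the order, are asymptotically
distributed in every interval according to the area. -/
def IsEquidistributed (A : Set (ℝ × ℝ)) : Prop :=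
  ∀ α β : ℝ, 0 ≤ α → α ≤ β → β ≤ 1 →
    Tendsto (fun Q : ℕ => ((neighbourPairs A α β Q).card : ℝ) / (Q : ℝ) ^ 2) atTop
      (𝓝 (coprimeDensity * volume.real (A ∩ fareyTriangle) * (β - α)))

theorem neighbourPairs_unitSquare_inter (A : Set (ℝ × ℝ)) (α β : ℝ) {Q : ℕ} (hQ : 0 < Q) :
    neighbourPairs (unitSquare ∩ A) α β Q = neighbourPairs A α β Q := by
  ext z
  rw [mem_neighbourPairs hQ, mem_neighbourPairs hQ]
  have hQ' : (0 : ℝ) < Q := by exact_mod_cast hQ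
  have key : 0 < z.1 → 0 < z.2 → z.1 ≤ Q → z.2 ≤ Q →
      ((z.1 : ℝ) / Q, (z.2 : ℝ) / Q) ∈ unitSquare := fun h1 h2 h3 h4 =>
    ⟨⟨by positivity, (div_le_one hQ').2 (by exact_mod_cast h3)⟩,
      ⟨by positivity, (div_le_one hQ').2 (by exact_mod_cast h4)⟩⟩
  rw [mem_inter_iff]
  tauto

theorem IsStarRegion.isEquidistributed {A : Set (ℝ × ℝ)} (hA : IsStarRegion (unitSquare ∩ A))
    (hsec : ∀ x, OrdConnected {y | (x, y) ∈ unitSquare ∩ A}) : IsEquidistributed A := by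
  intro α β h1 h2 h3
  have h := hA.tendsto_card_neighbourPairs hsec h1 h2 h3
  rw [inter_comm unitSquare A, inter_assoc, inter_comm A] at h
  change Tendsto _ _ (𝓝 (_ * volume.real (A ∩ fareyTriangle) * _)) at h
  refine h.congr' ?_
  filter_upwards [eventually_gt_atTop 0] with Q hQ
  rw [neighbourPairs_unitSquare_inter A α β hQ]

theorem frontier_unitSquare_subset {B : Set (ℝ × ℝ)} (hB : B ⊆ unitSquare) :
    frontier B ⊆ ({0, 1} ×ˢ univ ∪ univ ×ˢ {0, 1}) ∪ frontier B ∩ Ioo 0 1 ×ˢ Ioo 0 1 := by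
  intro z hz
  have hcl : z ∈ Icc (0 : ℝ) 1 ×ˢ Icc (0 : ℝ) 1 :=
    closure_minimal (hB.trans (prod_mono Ioc_subset_Icc_self Ioc_subset_Icc_self))
      (isClosed_Icc.prod isClosed_Icc) (frontier_subset_closure hz)
  by_cases h : z ∈ Ioo (0 : ℝ) 1 ×ˢ Ioo (0 : ℝ) 1
  · exact Or.inr ⟨hz, h⟩
  · left
    rcases eq_or_ne z.1 0 with h1 | h1
    · exact Or.inl ⟨Or.inl h1, trivial⟩
    rcases eq_or_ne z.1 1 with h2 | h2
    · exact Or.inl ⟨Or.inr h2, trivial⟩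
    rcases eq_or_ne z.2 0 with h3 | h3
    · exact Or.inr ⟨trivial, Or.inl h3⟩
    rcases eq_or_ne z.2 1 with h4 | h4
    · exact Or.inr ⟨trivial, Or.inr h4⟩
    exact absurd ⟨⟨lt_of_le_of_ne hcl.1.1 h1.symm, lt_of_le_of_ne hcl.1.2 h2⟩,
      ⟨lt_of_le_of_ne hcl.2.1 h3.symm, lt_of_le_of_ne hcl.2.2 h4⟩⟩ h

theorem volume_boundary_lines :
    volume (({0, 1} : Set ℝ) ×ˢ (univ : Set ℝ) ∪ (univ : Set ℝ) ×ˢ ({0, 1} : Set ℝ)) = 0 := by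
  have h : volume ({0, 1} : Set ℝ) = 0 := (Set.toFinite _).measure_zero _
  refine measure_union_null ?_ ?_ <;>
  · rw [Measure.volume_eq_prod, Measure.prod_prod, h]; simp

section Level

variable {F : ℝ → ℝ → ℝ} {t : ℝ}

/-- A region cut out of the unit square by a level set of a continuous function has null
frontier. -/
theorem volume_frontier_eq_zero_of_level
    (hc : ContinuousOn (fun z : ℝ × ℝ => F z.1 z.2) (Ioi 0 ×ˢ Ioi 0))
    (hfin : ∀ x ∈ Ioc (0 : ℝ) 1, {y ∈ Ioc (0 : ℝ) 1 | F x y = t}.Finite)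
    {B : Set (ℝ × ℝ)} (hB : B = unitSquare ∩ {z | t ≤ F z.1 z.2} ∨
      B = unitSquare ∩ {z | F z.1 z.2 < t}) : volume (frontier B) = 0 := by
  have hBU : B ⊆ unitSquare := by rcases hB with rfl | rfl <;> exact inter_subset_left
  set O : Set (ℝ × ℝ) := Ioo 0 1 ×ˢ Ioo 0 1 with hO
  have hOo : IsOpen O := isOpen_Ioo.prod isOpen_Ioo
  have hOU : O ⊆ unitSquare := prod_mono Ioo_subset_Ioc_self Ioo_subset_Ioc_self
  have hcO : ContinuousOn (fun z : ℝ × ℝ => F z.1 z.2) O :=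
    hc.mono (prod_mono Ioo_subset_Ioi_self Ioo_subset_Ioi_self)
  -- The level curve in the open square, written as a difference of open sets to make it measurable,
  -- is null by its finite sections. Off the curve the sign of F - t is locally constant, so there
  -- is no frontier.
  have hlev : volume (O \ (O ∩ (fun z : ℝ × ℝ => F z.1 z.2) ⁻¹' {t}ᶜ)) = 0 := by
    refine volume_eq_zero_of_sections (hOo.measurableSet.diff
      (hcO.isOpen_inter_preimage hOo isOpen_compl_singleton).measurableSet) fun x => ?_
    by_cases hx : x ∈ Ioc (0 : ℝ) 1
    · refine (hfin x hx).subset ?_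
      rintro y ⟨hy1, hy2⟩
      refine ⟨(hOU hy1).2, ?_⟩
      by_contra hne
      exact hy2 ⟨hy1, hne⟩
    · convert Set.finite_empty
      rw [Set.eq_empty_iff_forall_notMem]
      exact fun y hy => hx (hOU hy.1).1
  refine measure_mono_null (frontier_unitSquare_subset hBU)
    (measure_union_null volume_boundary_lines (measure_mono_null ?_ hlev))
  rintro z ⟨hz, hzO⟩
  refine ⟨hzO, fun hz' => ?_⟩
  have hne : F z.1 z.2 ≠ t := hz'.2
  have hgt : t < F z.1 z.2 → ∀ᶠ w in 𝓝 z, w ∈ O ∧ t < F w.1 w.2 := fun h =>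
    (hOo.eventually_mem hzO).and ((hcO.continuousAt (hOo.mem_nhds hzO)).eventually_const_lt h)
  have hlt : F z.1 z.2 < t → ∀ᶠ w in 𝓝 z, w ∈ O ∧ F w.1 w.2 < t := fun h =>
    (hOo.eventually_mem hzO).and ((hcO.continuousAt (hOo.mem_nhds hzO)).eventually_lt_const h)
  have hcase : B ∈ 𝓝 z ∨ Bᶜ ∈ 𝓝 z := by
    rcases hB with rfl | rfl
    · rcases lt_or_gt_of_ne hne with h | h
      · right; filter_upwards [hlt h] with w hw using fun h' => absurd hw.2 (not_lt.2 h'.2)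
      · left; filter_upwards [hgt h] with w hw using ⟨hOU hw.1, hw.2.le⟩
    · rcases lt_or_gt_of_ne hne with h | h
      · left; filter_upwards [hlt h] with w hw using ⟨hOU hw.1, hw.2⟩
      · right; filter_upwards [hgt h] with w hw using fun h' => absurd hw.2 (not_lt.2 (le_of_lt h'.2))
  rcases hcase with h | h
  · exact hz.2 (mem_interior_iff_mem_nhds.2 h)
  · rw [← frontier_compl] at hz
    exact hz.2 (mem_interior_iff_mem_nhds.2 h)

theorem measurableSet_unitSquare_inter_lt
    (hc : ContinuousOn (fun z : ℝ × ℝ => F z.1 z.2) (Ioi 0 ×ˢ Ioi 0)) :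
    MeasurableSet (unitSquare ∩ {z | F z.1 z.2 < t}) := by
  have h := (hc.isOpen_inter_preimage (isOpen_Ioi.prod isOpen_Ioi)
    (isOpen_Iio (a := t))).measurableSet
  convert measurableSet_unitSquare.inter h using 1
  ext z
  exact ⟨fun hz => ⟨hz.1, ⟨hz.1.1.1, hz.1.2.1⟩, hz.2⟩, fun hz => ⟨hz.1, hz.2.2⟩⟩

theorem measurableSet_unitSquare_inter_le
    (hc : ContinuousOn (fun z : ℝ × ℝ => F z.1 z.2) (Ioi 0 ×ˢ Ioi 0)) :
    MeasurableSet (unitSquare ∩ {z | t ≤ F z.1 z.2}) := by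
  convert measurableSet_unitSquare.diff (measurableSet_unitSquare_inter_lt (t := t) hc) using 1
  ext z
  simp only [mem_inter_iff, Set.mem_ofPred_eq, Set.mem_sdiff, not_and, not_lt]
  tauto

theorem isEquidistributed_superlevel
    (hc : ContinuousOn (fun z : ℝ × ℝ => F z.1 z.2) (Ioi 0 ×ˢ Ioi 0))
    (hfin : ∀ x ∈ Ioc (0 : ℝ) 1, {y ∈ Ioc (0 : ℝ) 1 | F x y = t}.Finite)
    (hstar : ∀ r x y : ℝ, 0 < r → r ≤ 1 → 0 < x → 0 < y → t ≤ F x y → t ≤ F (r * x) (r * y))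
    (hsec : ∀ x ∈ Ioc (0 : ℝ) 1, OrdConnected {y ∈ Ioc (0 : ℝ) 1 | t ≤ F x y}) :
    IsEquidistributed {z | t ≤ F z.1 z.2} := by
  refine IsStarRegion.isEquidistributed ⟨inter_subset_left, measurableSet_unitSquare_inter_le hc,
    volume_frontier_eq_zero_of_level hc hfin (Or.inl rfl), ?_⟩ fun x => ?_
  · rintro r hr0 hr1 z ⟨hz, hzF⟩
    refine ⟨⟨⟨mul_pos hr0 hz.1.1, ?_⟩, ⟨mul_pos hr0 hz.2.1, ?_⟩⟩,
      hstar r z.1 z.2 hr0 hr1 hz.1.1 hz.2.1 hzF⟩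
    · exact mul_le_one₀ hr1 hz.1.1.le hz.1.2
    · exact mul_le_one₀ hr1 hz.2.1.le hz.2.2
  · by_cases hx : x ∈ Ioc (0 : ℝ) 1
    · convert hsec x hx using 1
      ext y
      exact ⟨fun h => ⟨h.1.2, h.2⟩, fun h => ⟨⟨hx, h.1⟩, h.2⟩⟩
    · convert ordConnected_empty
      rw [Set.eq_empty_iff_forall_notMem]
      exact fun y hy => hx hy.1.1

theorem isEquidistributed_univ : IsEquidistributed univ := by
  -- The level differs from the constant value, so the level curve is empty.
  have := isEquidistributed_superlevel (F := fun _ _ => 1) (t := 0) continuousOn_const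
    (by simp) (by simp) (fun x _ => by
      convert (ordConnected_Ioc : OrdConnected (Ioc (0 : ℝ) 1)) using 1
      ext y; simp)
  simpa using this

theorem card_neighbourPairs_add_compl (A : Set (ℝ × ℝ)) (α β : ℝ) {Q : ℕ} (hQ : 0 < Q) :
    (neighbourPairs A α β Q).card + (neighbourPairs Aᶜ α β Q).card =
      (neighbourPairs univ α β Q).card := by
  classical
  rw [← Finset.card_union_of_disjoint]
  · congr 1
    ext z
    rw [Finset.mem_union, mem_neighbourPairs hQ, mem_neighbourPairs hQ, mem_neighbourPairs hQ,
      mem_compl_iff]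
    have := mem_univ ((z.1 : ℝ) / Q, (z.2 : ℝ) / Q)
    tauto
  · rw [Finset.disjoint_left]
    intro z h1 h2
    exact ((mem_neighbourPairs hQ).1 h2).1 ((mem_neighbourPairs hQ).1 h1).1

/-- Counts and areas are additive, so complements inherit equidistribution even when they are not
star-shaped or lack interval sections. -/
theorem IsEquidistributed.compl {A : Set (ℝ × ℝ)} (hA : IsEquidistributed A)
    (hm : MeasurableSet (unitSquare ∩ A)) : IsEquidistributed Aᶜ := by
  intro α β h1 h2 h3
  have h := (isEquidistributed_univ α β h1 h2 h3).sub (hA α β h1 h2 h3)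
  have hv : volume.real (univ ∩ fareyTriangle) =
      volume.real (A ∩ fareyTriangle) + volume.real (Aᶜ ∩ fareyTriangle) := by
    have hm' : MeasurableSet (A ∩ fareyTriangle) := by
      have := hm.inter measurableSet_fareyHalfPlane
      rwa [inter_comm unitSquare A, inter_assoc] at this
    have e1 : fareyTriangle ∩ (A ∩ fareyTriangle) = A ∩ fareyTriangle :=
      inter_eq_right.2 inter_subset_right
    have e2 : fareyTriangle \ (A ∩ fareyTriangle) = Aᶜ ∩ fareyTriangle := by
      ext z; simp only [Set.mem_sdiff, mem_inter_iff, mem_compl_iff]; tauto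
    rw [univ_inter, ← measureReal_inter_add_sdiff hm'
      (volume_ne_top_of_subset_fareyTriangle subset_rfl), e1, e2]
  rw [hv] at h
  have e : coprimeDensity * (volume.real (A ∩ fareyTriangle) +
      volume.real (Aᶜ ∩ fareyTriangle)) * (β - α) - coprimeDensity *
      volume.real (A ∩ fareyTriangle) * (β - α) =
      coprimeDensity * volume.real (Aᶜ ∩ fareyTriangle) * (β - α) := by ring
  rw [e] at h
  refine h.congr' ?_
  filter_upwards [eventually_gt_atTop 0] with Q hQ
  rw [← sub_div, ← card_neighbourPairs_add_compl A α β hQ]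
  push_cast; ring

/-- Serves the hyperbolic distance, whose sections in y are intervals below a level but not above
it. -/
theorem isEquidistributed_of_sublevel
    (hc : ContinuousOn (fun z : ℝ × ℝ => F z.1 z.2) (Ioi 0 ×ˢ Ioi 0))
    (hfin : ∀ x ∈ Ioc (0 : ℝ) 1, {y ∈ Ioc (0 : ℝ) 1 | F x y = t}.Finite)
    (hstar : ∀ r x y : ℝ, 0 < r → r ≤ 1 → 0 < x → 0 < y → F x y < t → F (r * x) (r * y) < t)
    (hsec : ∀ x ∈ Ioc (0 : ℝ) 1, OrdConnected {y ∈ Ioc (0 : ℝ) 1 | F x y < t}) :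
    IsEquidistributed {z | t ≤ F z.1 z.2} := by
  have hlt : IsEquidistributed {z | F z.1 z.2 < t} := by
    refine IsStarRegion.isEquidistributed ⟨inter_subset_left, measurableSet_unitSquare_inter_lt hc,
      volume_frontier_eq_zero_of_level hc hfin (Or.inr rfl), ?_⟩ fun x => ?_
    · rintro r hr0 hr1 z ⟨hz, hzF⟩
      refine ⟨⟨⟨mul_pos hr0 hz.1.1, ?_⟩, ⟨mul_pos hr0 hz.2.1, ?_⟩⟩,
        hstar r z.1 z.2 hr0 hr1 hz.1.1 hz.2.1 hzF⟩
      · exact mul_le_one₀ hr1 hz.1.1.le hz.1.2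
      · exact mul_le_one₀ hr1 hz.2.1.le hz.2.2
    · by_cases hx : x ∈ Ioc (0 : ℝ) 1
      · convert hsec x hx using 1
        ext y
        exact ⟨fun h => ⟨h.1.2, h.2⟩, fun h => ⟨⟨hx, h.1⟩, h.2⟩⟩
      · convert ordConnected_empty
        rw [Set.eq_empty_iff_forall_notMem]
        exact fun y hy => hx hy.1.1
  have := hlt.compl (measurableSet_unitSquare_inter_lt hc)
  convert this using 1
  ext z; simp

end Level

/-! ### From counts to the limiting distribution -/

theorem tendsto_order_atTop : Tendsto order (𝓝[>] 0) atTop := by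
  unfold order
  refine tendsto_nat_floor_atTop.comp ?_
  have h : Tendsto (fun δ : ℝ => 2 * δ) (𝓝[>] 0) (𝓝[>] 0) := by
    refine tendsto_nhdsWithin_iff.2 ⟨?_, ?_⟩
    · exact (Continuous.tendsto' (by fun_prop) 0 0 (by simp)).mono_left nhdsWithin_le_nhds
    · filter_upwards [self_mem_nhdsWithin] with δ hδ
      simpa using hδ
  exact (tendsto_rpow_neg_nhdsGT_zero (by norm_num)).comp h

/-- The area of the part of the Farey triangle where `F ≥ t`, normalised to total mass `1`. -/
noncomputable def tailArea (F : ℝ → ℝ → ℝ) (t : ℝ) : ℝ :=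
  2 * volume.real ({z : ℝ × ℝ | t ≤ F z.1 z.2} ∩ fareyTriangle)

/-- Numerator and denominator differ from counts of `neighbourPairs` by at most 1, so both converge
after division by Q². In the quotient `coprimeDensity` and β - α cancel, and the area 1/2 of the
triangle produces the factor 2. -/
theorem isLimitingDistribution_tailArea {F : ℝ → ℝ → ℝ}
    (hvol : volume.real fareyTriangle = 1 / 2)
    (hF : ∀ t, IsEquidistributed {z | t ≤ F z.1 z.2}) :
    IsLimitingDistribution F (tailArea F) := by
  intro α β hα hαβ hβ t
  suffices h : Tendsto (fun Q : ℕ => ({z ∈ consecutivePairs α β Q |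
      t ≤ F (z.1.den / Q) (z.2.den / Q)}.ncard : ℝ) / ((fareyPoints α β Q).ncard : ℝ)) atTop
      (𝓝 (tailArea F t)) from h.comp tendsto_order_atTop
  have hsq : Tendsto (fun Q : ℕ => 1 / (Q : ℝ) ^ 2) atTop (𝓝 0) :=
    (tendsto_const_nhds (x := (1 : ℝ))).div_atTop
      ((tendsto_pow_atTop two_ne_zero).comp tendsto_natCast_atTop_atTop)
  have hY := hF t α β hα hαβ.le hβ
  have hU := isEquidistributed_univ α β hα hαβ.le hβ
  rw [univ_inter, hvol] at hU
  have hX : Tendsto (fun Q : ℕ => ({z ∈ consecutivePairs α β Q |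
      t ≤ F (z.1.den / Q) (z.2.den / Q)}.ncard : ℝ) / (Q : ℝ) ^ 2) atTop
      (𝓝 (coprimeDensity * volume.real ({z : ℝ × ℝ | t ≤ F z.1 z.2} ∩ fareyTriangle) *
        (β - α))) := by
    have hlow := hY.sub hsq
    rw [sub_zero] at hlow
    refine tendsto_of_tendsto_of_tendsto_of_le_of_le' hlow hY ?_ ?_
    · filter_upwards [eventually_gt_atTop 0] with Q hQ
      rw [← sub_div]
      gcongr
      have := card_neighbourPairs_le (A := {z | t ≤ F z.1 z.2}) (α := α) (β := β) hQ
      rw [sub_le_iff_le_add]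
      exact_mod_cast this
    · filter_upwards [eventually_gt_atTop 0] with Q hQ
      gcongr
      exact ncard_consecutivePairs_le (A := {z | t ≤ F z.1 z.2}) hQ
  have hN : Tendsto (fun Q : ℕ => ((fareyPoints α β Q).ncard : ℝ) / (Q : ℝ) ^ 2) atTop
      (𝓝 (coprimeDensity * (1 / 2) * (β - α))) := by
    have hup := hU.add hsq
    rw [add_zero] at hup
    have hsame : ∀ Q : ℕ, 0 < Q → neighbourPairs (Ioc 0 1 ×ˢ Ioc 0 1) α β Q =
        neighbourPairs univ α β Q := fun Q hQ => by
      rw [← neighbourPairs_unitSquare_inter univ α β hQ, inter_univ]; rfl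
    refine tendsto_of_tendsto_of_tendsto_of_le_of_le' hU hup ?_ ?_
    · filter_upwards [eventually_gt_atTop 0] with Q hQ
      gcongr
      rw [← hsame Q hQ]
      exact card_neighbourPairs_le_ncard_fareyPoints hQ
    · filter_upwards [eventually_gt_atTop 0] with Q hQ
      rw [← add_div]
      gcongr
      have := ncard_fareyPoints_le (α := α) (β := β) hQ
      rw [hsame Q hQ] at this
      exact_mod_cast this
  have hβα : β - α ≠ 0 := by linarith
  have hne : coprimeDensity * (1 / 2) * (β - α) ≠ 0 :=
    mul_ne_zero (mul_ne_zero coprimeDensity_ne_zero (by norm_num)) hβα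
  have hlim := hX.div hN hne
  have e : coprimeDensity * volume.real ({z : ℝ × ℝ | t ≤ F z.1 z.2} ∩ fareyTriangle) * (β - α) /
      (coprimeDensity * (1 / 2) * (β - α)) = tailArea F t := by
    have := coprimeDensity_ne_zero
    rw [tailArea]; field_simp
  rw [e] at hlim
  refine hlim.congr' ?_
  filter_upwards [eventually_gt_atTop 0] with Q hQ
  have : (0 : ℝ) < (Q : ℝ) ^ 2 := by positivity
  simp only [Pi.div_apply]
  rw [div_div_div_cancel_right₀ this.ne']

/-! ### Corner areas and tail bounds -/

theorem volume_real_of_sections {S : Set (ℝ × ℝ)} (hS : MeasurableSet S) {a b : ℝ} (hab : a ≤ b)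
    {f g : ℝ → ℝ} (hf : Continuous f) (hg : Continuous g) (hfg : ∀ x ∈ Ioc a b, f x ≤ g x)
    (hin : ∀ x ∈ Ioc a b, {y | (x, y) ∈ S} = Ioc (f x) (g x))
    (hout : ∀ x, x ∉ Ioc a b → {y | (x, y) ∈ S} = ∅) :
    volume.real S = ∫ x in a..b, (g x - f x) := by
  have hnn : 0 ≤ᵐ[volume.restrict (Ioc a b)] fun x => g x - f x := by
    filter_upwards [ae_restrict_mem measurableSet_Ioc] with x hx using sub_nonneg.2 (hfg x hx)
  have h1 : volume S = ∫⁻ x in Ioc a b, ENNReal.ofReal (g x - f x) := by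
    rw [Measure.volume_eq_prod, Measure.prod_apply hS, ← lintegral_indicator measurableSet_Ioc]
    refine lintegral_congr fun x => ?_
    by_cases hx : x ∈ Ioc a b
    · rw [indicator_of_mem hx, ← Real.volume_Ioc, ← hin x hx]; rfl
    · rw [indicator_of_notMem hx]
      have := hout x hx
      change volume {y | (x, y) ∈ S} = 0
      rw [this, measure_empty]
  have hint : IntegrableOn (fun x => g x - f x) (Ioc a b) := ((hg.sub hf).intervalIntegrable a b).1
  rw [measureReal_def, h1, intervalIntegral.integral_of_le hab,
    ← ofReal_integral_eq_lintegral_ofReal hint hnn,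
    ENNReal.toReal_ofReal (integral_nonneg_of_ae hnn)]

theorem volume_real_preimage_swap (S : Set (ℝ × ℝ)) :
    volume.real (Prod.swap ⁻¹' S) = volume.real S := by
  rw [measureReal_def, measureReal_def]
  congr 1
  exact Measure.measurePreserving_swap.measure_preimage_equiv (f := MeasurableEquiv.prodComm) S

/-- The corner of the Farey triangle near `(0, 1)`. -/
def leftCorner (c : ℝ) : Set (ℝ × ℝ) := {z | z.1 ≤ c} ∩ fareyTriangle

/-- The corner of the Farey triangle near `(1, 0)`. -/
def bottomCorner (c : ℝ) : Set (ℝ × ℝ) := {z | z.2 ≤ c} ∩ fareyTriangle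

theorem measurableSet_leftCorner (c : ℝ) : MeasurableSet (leftCorner c) :=
  (measurableSet_le measurable_fst measurable_const).inter measurableSet_fareyTriangle

theorem measurableSet_bottomCorner (c : ℝ) : MeasurableSet (bottomCorner c) :=
  (measurableSet_le measurable_snd measurable_const).inter measurableSet_fareyTriangle

/-- A right triangle with both legs c; in the normalisation of `tailArea` it weighs c². -/
theorem volume_real_leftCorner {c : ℝ} (h0 : 0 ≤ c) (h1 : c ≤ 1) :
    volume.real (leftCorner c) = c ^ 2 / 2 := by
  rw [volume_real_of_sections (measurableSet_leftCorner c) h0 (f := fun x => 1 - x) (g := fun _ => 1)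
    (by fun_prop) (by fun_prop)]
  · simp
  · intro x hx; linarith [hx.1]
  · intro x hx
    ext y
    simp only [leftCorner, mem_inter_iff, mem_fareyTriangle, Set.mem_ofPred_eq, mem_Ioc]
    have := hx.1; have := hx.2
    constructor
    · rintro ⟨_, ⟨_, _, _⟩, _⟩; constructor <;> linarith
    · rintro ⟨_, _⟩; refine ⟨hx.2, ⟨⟨hx.1, by linarith⟩, by linarith, by linarith⟩, by linarith⟩
  · intro x hx
    rw [Set.eq_empty_iff_forall_notMem]
    intro y hy
    exact hx ⟨hy.2.1.1.1, hy.1⟩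

theorem volume_real_bottomCorner {c : ℝ} (h0 : 0 ≤ c) (h1 : c ≤ 1) :
    volume.real (bottomCorner c) = c ^ 2 / 2 := by
  rw [← volume_real_leftCorner h0 h1, ← volume_real_preimage_swap (leftCorner c)]
  congr 1
  ext z
  simp only [bottomCorner, leftCorner, mem_preimage, mem_inter_iff, mem_fareyTriangle,
    Set.mem_ofPred_eq, Prod.fst_swap, Prod.snd_swap, add_comm z.2 z.1]
  tauto

theorem volume_real_fareyTriangle : volume.real fareyTriangle = 1 / 2 := by
  have h := volume_real_leftCorner zero_le_one le_rfl
  have e : leftCorner 1 = fareyTriangle := inter_eq_right.2 fun z hz => hz.1.1.2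
  rw [e] at h; rw [h]; norm_num

section Tail

variable {F : ℝ → ℝ → ℝ} {t c : ℝ}

theorem sq_le_tailArea_of_leftCorner (h0 : 0 ≤ c) (h1 : c ≤ 1)
    (h : ∀ z ∈ fareyTriangle, z.1 ≤ c → t ≤ F z.1 z.2) : c ^ 2 ≤ tailArea F t := by
  have := measureReal_mono (μ := volume) (s₁ := leftCorner c)
    (s₂ := {z : ℝ × ℝ | t ≤ F z.1 z.2} ∩ fareyTriangle) (fun z hz => ⟨h z hz.2 hz.1, hz.2⟩)
    (volume_ne_top_of_subset_fareyTriangle inter_subset_right)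
  rw [volume_real_leftCorner h0 h1] at this
  rw [tailArea]; linarith

theorem sq_le_tailArea_of_bottomCorner (h0 : 0 ≤ c) (h1 : c ≤ 1)
    (h : ∀ z ∈ fareyTriangle, z.2 ≤ c → t ≤ F z.1 z.2) : c ^ 2 ≤ tailArea F t := by
  have := measureReal_mono (μ := volume) (s₁ := bottomCorner c)
    (s₂ := {z : ℝ × ℝ | t ≤ F z.1 z.2} ∩ fareyTriangle) (fun z hz => ⟨h z hz.2 hz.1, hz.2⟩)
    (volume_ne_top_of_subset_fareyTriangle inter_subset_right)
  rw [volume_real_bottomCorner h0 h1] at this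
  rw [tailArea]; linarith

/-- For c ≤ 1/2 the corners are disjoint, because x + y > 1, so their weights add. -/
theorem two_mul_sq_le_tailArea_of_corners (h0 : 0 ≤ c) (h1 : c ≤ 1 / 2)
    (h : ∀ z ∈ fareyTriangle, z.1 ≤ c ∨ z.2 ≤ c → t ≤ F z.1 z.2) :
    2 * c ^ 2 ≤ tailArea F t := by
  have hdisj : Disjoint (leftCorner c) (bottomCorner c) := by
    rw [Set.disjoint_left]
    rintro z ⟨hz1, hz⟩ ⟨hz2, -⟩
    have := hz.2
    simp only [fareyHalfPlane, Set.mem_ofPred_eq] at this hz1 hz2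
    linarith
  have := measureReal_mono (μ := volume) (s₁ := leftCorner c ∪ bottomCorner c)
    (s₂ := {z : ℝ × ℝ | t ≤ F z.1 z.2} ∩ fareyTriangle)
    (by rintro z (hz | hz); exacts [⟨h z hz.2 (Or.inl hz.1), hz.2⟩, ⟨h z hz.2 (Or.inr hz.1), hz.2⟩])
    (volume_ne_top_of_subset_fareyTriangle inter_subset_right)
  rw [measureReal_union hdisj (measurableSet_bottomCorner c)
    (volume_ne_top_of_subset_fareyTriangle inter_subset_right)
    (volume_ne_top_of_subset_fareyTriangle inter_subset_right),
    volume_real_leftCorner h0 (by linarith), volume_real_bottomCorner h0 (by linarith)] at this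
  rw [tailArea]; linarith

theorem tailArea_le_of_bottomCorner (h0 : 0 ≤ c) (h1 : c ≤ 1)
    (h : ∀ z ∈ fareyTriangle, t ≤ F z.1 z.2 → z.2 ≤ c) : tailArea F t ≤ c ^ 2 := by
  have := measureReal_mono (μ := volume) (s₁ := {z : ℝ × ℝ | t ≤ F z.1 z.2} ∩ fareyTriangle)
    (s₂ := bottomCorner c) (fun z hz => ⟨h z hz.2 hz.1, hz.2⟩)
    (volume_ne_top_of_subset_fareyTriangle inter_subset_right)
  rw [volume_real_bottomCorner h0 h1] at this
  rw [tailArea]; linarith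

theorem tailArea_le_of_corners (h0 : 0 ≤ c) (h1 : c ≤ 1)
    (h : ∀ z ∈ fareyTriangle, t ≤ F z.1 z.2 → z.1 ≤ c ∨ z.2 ≤ c) :
    tailArea F t ≤ 2 * c ^ 2 := by
  have h2 := measureReal_mono (μ := volume) (s₁ := {z : ℝ × ℝ | t ≤ F z.1 z.2} ∩ fareyTriangle)
    (s₂ := leftCorner c ∪ bottomCorner c)
    (fun z hz => (h z hz.2 hz.1).imp (fun h => ⟨h, hz.2⟩) (fun h => ⟨h, hz.2⟩))
    (volume_ne_top_of_subset_fareyTriangle (union_subset inter_subset_right inter_subset_right))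
  have h3 := measureReal_union_le (μ := volume) (leftCorner c) (bottomCorner c)
  rw [volume_real_leftCorner h0 h1, volume_real_bottomCorner h0 h1] at h3
  rw [tailArea]; linarith

end Tail

theorem isTheta_of_le_of_le {G g : ℝ → ℝ} {a b : ℝ} (ha : 0 < a)
    (hg : ∀ᶠ t in atTop, 0 ≤ g t) (h1 : ∀ᶠ t in atTop, a * g t ≤ G t)
    (h2 : ∀ᶠ t in atTop, G t ≤ b * g t) : G =Θ[atTop] g := by
  refine ⟨IsBigO.of_bound b ?_, IsBigO.of_bound a⁻¹ ?_⟩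
  · filter_upwards [hg, h1, h2] with t h0 h1 h2
    rw [Real.norm_of_nonneg h0, Real.norm_of_nonneg ((by positivity : 0 ≤ a * g t).trans h1)]
    exact h2
  · filter_upwards [hg, h1] with t h0 h1
    rw [Real.norm_of_nonneg h0, Real.norm_of_nonneg ((by positivity : 0 ≤ a * g t).trans h1),
      inv_mul_eq_div, le_div_iff₀ ha, mul_comm]
    exact h1

/-- The criterion for functions that decrease in the second variable and whose superlevel sets are
star-shaped. -/
theorem isEquidistributed_of_strictAntiOn {F : ℝ → ℝ → ℝ} {t : ℝ}
    (hc : ContinuousOn (fun z : ℝ × ℝ => F z.1 z.2) (Ioi 0 ×ˢ Ioi 0))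
    (hanti : ∀ x, 0 < x → StrictAntiOn (F x) (Ioi 0))
    (hstar : (∀ r x y : ℝ, 0 < r → r ≤ 1 → 0 < x → 0 < y → t ≤ F x y → t ≤ F (r * x) (r * y)) ∨
      ∀ r x y : ℝ, 0 < r → r ≤ 1 → 0 < x → 0 < y → F x y < t → F (r * x) (r * y) < t) :
    IsEquidistributed {z | t ≤ F z.1 z.2} := by
  have hfin : ∀ x ∈ Ioc (0 : ℝ) 1, {y ∈ Ioc (0 : ℝ) 1 | F x y = t}.Finite := fun x hx =>
    Set.Subsingleton.finite fun y hy z hz =>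
      (hanti x hx.1).injOn hy.1.1 hz.1.1 (hy.2.trans hz.2.symm)
  rcases hstar with h | h
  · refine isEquidistributed_superlevel hc hfin h fun x hx => ⟨fun y hy z hz w hw => ?_⟩
    have hw0 : 0 < w := hy.1.1.trans_le hw.1
    exact ⟨⟨hw0, hw.2.trans hz.1.2⟩, hz.2.trans ((hanti x hx.1).antitoneOn hw0 hz.1.1 hw.2)⟩
  · refine isEquidistributed_of_sublevel hc hfin h fun x hx => ⟨fun y hy z hz w hw => ?_⟩
    have hw0 : 0 < w := hy.1.1.trans_le hw.1
    exact ⟨⟨hw0, hw.2.trans hz.1.2⟩,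
      ((hanti x hx.1).antitoneOn hy.1.1 hw0 hw.1).trans_lt hy.2⟩

/-! ### Euclidean distance -/

theorem isLimitingDistribution_euclideanDistance :
    IsLimitingDistribution (fun x y => 1 / (2 * x ^ 2) + 1 / (2 * y ^ 2))
      (tailArea fun x y => 1 / (2 * x ^ 2) + 1 / (2 * y ^ 2)) := by
  refine isLimitingDistribution_tailArea volume_real_fareyTriangle fun t =>
    isEquidistributed_of_strictAntiOn
      (F := fun x y => 1 / (2 * x ^ 2) + 1 / (2 * y ^ 2)) ?_ ?_ (Or.inl ?_)
  · refine (continuousOn_const.div (continuousOn_const.mul (continuousOn_fst.pow 2))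
      fun z hz => ?_).add (continuousOn_const.div (continuousOn_const.mul (continuousOn_snd.pow 2))
      fun z hz => ?_)
    all_goals
      have h1 : 0 < z.1 := hz.1
      have h2 : 0 < z.2 := hz.2
      first | positivity | (simp only [Pi.mul_apply, Pi.pow_apply]; positivity)
  · intro x hx y hy z hz hyz
    have hy' : 0 < y := hy
    have : 1 / (2 * z ^ 2) < 1 / (2 * y ^ 2) :=
      one_div_lt_one_div_of_lt (by positivity) (by gcongr)
    simp only
    linarith
  · intro r x y hr hr1 hx hy h
    have h1 : r * x ≤ x := mul_le_of_le_one_left hx.le hr1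
    have h2 : r * y ≤ y := mul_le_of_le_one_left hy.le hr1
    refine h.trans (add_le_add ?_ ?_)
    · exact one_div_le_one_div_of_le (by positivity) (by gcongr)
    · exact one_div_le_one_div_of_le (by positivity) (by gcongr)

/-- With c² = 1 / (2t), one coordinate at most c already makes its own term reach t. Both corners
qualify, with total weight 2c² = 1 / t. -/
theorem tailArea_euclideanDistance_ge {t : ℝ} (ht : 2 ≤ t) :
    1 / t ≤ tailArea (fun x y => 1 / (2 * x ^ 2) + 1 / (2 * y ^ 2)) t := by
  have ht0 : 0 < t := by linarith
  set c := Real.sqrt (1 / (2 * t)) with hc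
  have hc2 : c ^ 2 = 1 / (2 * t) := Real.sq_sqrt (by positivity)
  have hc0 : 0 ≤ c := Real.sqrt_nonneg _
  have hchalf : c ≤ 1 / 2 := by
    refine (Real.sqrt_le_left (by norm_num)).2 ?_
    rw [div_le_iff₀ (by positivity)]; linarith
  have key : ∀ x, 0 < x → x ≤ c → t ≤ 1 / (2 * x ^ 2) := fun x hx hxc => by
    rw [le_div_iff₀ (by positivity)]
    have : x ^ 2 ≤ 1 / (2 * t) := hc2 ▸ pow_le_pow_left₀ hx.le hxc 2
    rw [le_div_iff₀ (by positivity)] at this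
    linarith
  have := two_mul_sq_le_tailArea_of_corners (F := fun x y => 1 / (2 * x ^ 2) + 1 / (2 * y ^ 2))
    (t := t) hc0 hchalf fun z hz hor => ?_
  · rw [hc2] at this
    refine le_trans (le_of_eq ?_) this
    field_simp
  · have h1 : 0 < z.1 := hz.1.1.1
    have h2 : 0 < z.2 := hz.1.2.1
    have p1 : 0 < 1 / (2 * z.1 ^ 2) := by positivity
    have p2 : 0 < 1 / (2 * z.2 ^ 2) := by positivity
    rcases hor with h | h
    · have := key _ h1 h; linarith
    · have := key _ h2 h; linarith

/-- Some coordinate is at least 1/2 and contributes at most 2, so the other term is at least t - 2.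
-/
theorem tailArea_euclideanDistance_le {t : ℝ} (ht : 4 ≤ t) :
    tailArea (fun x y => 1 / (2 * x ^ 2) + 1 / (2 * y ^ 2)) t ≤ 1 / (t - 2) := by
  have ht0 : 0 < t - 2 := by linarith
  set c := Real.sqrt (1 / (2 * (t - 2))) with hc
  have hc2 : c ^ 2 = 1 / (2 * (t - 2)) := Real.sq_sqrt (by positivity)
  have hc0 : 0 ≤ c := Real.sqrt_nonneg _
  have hc1 : c ≤ 1 := by
    refine (Real.sqrt_le_left zero_le_one).2 ?_
    rw [div_le_iff₀ (by positivity)]; linarith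
  have key : ∀ x y, 0 < x → 1 / 2 ≤ y → t ≤ 1 / (2 * x ^ 2) + 1 / (2 * y ^ 2) → x ≤ c := by
    intro x y hx hy h
    have h1 : 1 / (2 * y ^ 2) ≤ 2 := by
      rw [div_le_iff₀ (by positivity)]; nlinarith
    have h2 : t - 2 ≤ 1 / (2 * x ^ 2) := by linarith
    rw [le_div_iff₀ (by positivity)] at h2
    refine Real.le_sqrt_of_sq_le ?_
    rw [le_div_iff₀ (by positivity)]
    linarith
  have := tailArea_le_of_corners (F := fun x y => 1 / (2 * x ^ 2) + 1 / (2 * y ^ 2))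
    (t := t) hc0 hc1 fun z hz h => ?_
  · rw [hc2] at this
    refine this.trans (le_of_eq ?_)
    field_simp
  · obtain ⟨⟨⟨h1, -⟩, h2, -⟩, hsum⟩ := mem_fareyTriangle.1 hz
    rcases le_total (1 / 2 : ℝ) z.2 with h' | h'
    · exact Or.inl (key _ _ h1 h' h)
    · exact Or.inr (key _ z.1 h2 (by linarith) (by rw [add_comm]; exact h))

theorem tailArea_euclideanDistance_isEquivalent :
    tailArea (fun x y => 1 / (2 * x ^ 2) + 1 / (2 * y ^ 2)) ~[atTop] fun t => 1 / t := by
  refine isEquivalent_of_tendsto_one ?_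
  have hlim : Tendsto (fun t : ℝ => 1 + 2 * (t + -2)⁻¹) atTop (𝓝 1) := by
    simpa using ((tendsto_atTop_add_const_right atTop (-2 : ℝ) tendsto_id).inv_tendsto_atTop.const_mul
      2).const_add 1
  refine tendsto_of_tendsto_of_tendsto_of_le_of_le' tendsto_const_nhds hlim ?_ ?_
  · filter_upwards [eventually_ge_atTop 4] with t ht
    have := tailArea_euclideanDistance_ge (t := t) (by linarith)
    simp only [Pi.div_apply]
    rwa [le_div_iff₀ (by positivity), one_mul]
  · filter_upwards [eventually_ge_atTop 4] with t ht
    have := tailArea_euclideanDistance_le ht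
    have h2 : 0 < t - 2 := by linarith
    simp only [Pi.div_apply]
    rw [div_le_iff₀ (by positivity)]
    refine this.trans (le_of_eq ?_)
    rw [← sub_eq_add_neg]
    field_simp; ring

/-! ### Hyperbolic distance -/

theorem hyperbolicDistance_lt_iff {x y t : ℝ} (hx : 0 < x) (hy : 0 < y) :
    1 / 2 * (y / x + x / y) < t ↔ y ^ 2 - 2 * t * x * y + x ^ 2 < 0 := by
  have e : 1 / 2 * (y / x + x / y) = (y ^ 2 + x ^ 2) / (2 * x * y) := by field_simp
  rw [e, div_lt_iff₀ (by positivity)]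
  constructor <;> intro h <;> linarith

theorem isLimitingDistribution_hyperbolicDistance :
    IsLimitingDistribution (fun x y => 1 / 2 * (y / x + x / y))
      (tailArea fun x y => 1 / 2 * (y / x + x / y)) := by
  refine isLimitingDistribution_tailArea volume_real_fareyTriangle fun t =>
    isEquidistributed_of_sublevel
      (F := fun x y => 1 / 2 * (y / x + x / y)) ?_ ?_ ?_ ?_
  · refine continuousOn_const.mul ((continuousOn_snd.div continuousOn_fst fun z hz => ?_).add
      (continuousOn_fst.div continuousOn_snd fun z hz => ?_))
    all_goals
      have h1 : 0 < z.1 := hz.1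
      have h2 : 0 < z.2 := hz.2
      positivity
  · intro x hx
    refine (Set.toFinite {t * x + Real.sqrt ((t ^ 2 - 1) * x ^ 2),
      t * x - Real.sqrt ((t ^ 2 - 1) * x ^ 2)}).subset ?_
    rintro y ⟨hy, h⟩
    have hx0 := hx.1
    have hy0 := hy.1
    have e : (t ^ 2 - 1) * x ^ 2 = (y - t * x) ^ 2 := by
      rw [← h]; field_simp; ring
    rw [e, Real.sqrt_sq_eq_abs]
    rcases abs_cases (y - t * x) with ⟨h', -⟩ | ⟨h', -⟩
    · left; rw [h']; ring
    · right; rw [mem_singleton_iff, h']; ring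
  · intro r x y hr _ _ _ h
    rwa [mul_div_mul_left _ _ hr.ne', mul_div_mul_left _ _ hr.ne']
  · refine fun x hx => ⟨fun y hy z hz w hw => ?_⟩
    have hw0 : 0 < w := hy.1.1.trans_le hw.1
    refine ⟨⟨hw0, hw.2.trans hz.1.2⟩, ?_⟩
    have h1 := (hyperbolicDistance_lt_iff hx.1 hy.1.1).1 hy.2
    have h2 := (hyperbolicDistance_lt_iff hx.1 hz.1.1).1 hz.2
    refine (hyperbolicDistance_lt_iff hx.1 hw0).2 ?_
    rcases hw.1.eq_or_lt with rfl | hyw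
    · exact h1
    rcases hw.2.eq_or_lt with rfl | hwz
    · exact h2
    -- Convexity of a monic quadratic in explicit form: its second divided difference is 1.
    have e : (w ^ 2 - 2 * t * x * w + x ^ 2) * (z - y) =
        (y ^ 2 - 2 * t * x * y + x ^ 2) * (z - w) + (z ^ 2 - 2 * t * x * z + x ^ 2) * (w - y) -
        (w - y) * (z - w) * (z - y) := by ring
    have p1 := mul_neg_of_neg_of_pos h1 (sub_pos.2 hwz)
    have p2 := mul_neg_of_neg_of_pos h2 (sub_pos.2 hyw)
    have p3 : 0 < (w - y) * (z - w) * (z - y) :=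
      mul_pos (mul_pos (sub_pos.2 hyw) (sub_pos.2 hwz)) (sub_pos.2 (hyw.trans hwz))
    refine neg_of_mul_neg_left (b := z - y) ?_ (sub_pos.2 (hyw.trans hwz)).le
    linarith

/-- The region is the triangle with vertices (s/(s+1), 1/(s+1)), (1, 0) and (1, 1/s), of base 1/s
and height 1/(s+1). -/
theorem volume_real_cone {s : ℝ} (hs : 1 ≤ s) :
    volume.real ({z : ℝ × ℝ | s * z.2 ≤ z.1} ∩ fareyTriangle) = 1 / (2 * s * (s + 1)) := by
  have hs0 : 0 < s := by linarith
  have hm : MeasurableSet ({z : ℝ × ℝ | s * z.2 ≤ z.1} ∩ fareyTriangle) :=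
    (measurableSet_le (by fun_prop) (by fun_prop)).inter measurableSet_fareyTriangle
  have ha1 : s / (s + 1) ≤ 1 := by rw [div_le_one (by positivity)]; linarith
  have hiff : ∀ x : ℝ, s / (s + 1) < x ↔ 1 - x < x / s := fun x => by
    rw [div_lt_iff₀ (by positivity), lt_div_iff₀ hs0]
    constructor <;> intro h <;> linarith
  rw [volume_real_of_sections hm ha1 (f := fun x => 1 - x) (g := fun x => x / s)
    (by fun_prop) (by fun_prop)]
  · have e : ∀ x : ℝ, x / s - (1 - x) = (1 / s + 1) * x - 1 := fun x => by field_simp; ring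
    simp_rw [e]
    rw [intervalIntegral.integral_sub (Continuous.intervalIntegrable (by fun_prop) _ _)
      (Continuous.intervalIntegrable (by fun_prop) _ _), intervalIntegral.integral_const_mul,
      integral_id, intervalIntegral.integral_const, smul_eq_mul]
    field_simp
    ring
  · intro x hx; exact ((hiff x).1 hx.1).le
  · intro x hx
    have hx0 : 0 < x := lt_trans (by positivity) hx.1
    ext y
    simp only [mem_inter_iff, mem_fareyTriangle, Set.mem_ofPred_eq, mem_Ioc, le_div_iff₀ hs0]
    constructor
    · rintro ⟨h1, -, h2⟩; constructor <;> linarith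
    · rintro ⟨h1, h2⟩
      have hy0 : 0 < y := by linarith [hx.2]
      refine ⟨by linarith, ⟨⟨hx0, hx.2⟩, hy0, ?_⟩, by linarith⟩
      nlinarith [hx.2]
  · intro x hx
    rw [Set.eq_empty_iff_forall_notMem]
    rintro y ⟨hy, hyT⟩
    obtain ⟨⟨⟨h1, h1'⟩, h2, h2'⟩, hsum⟩ := mem_fareyTriangle.1 hyT
    refine hx ⟨(hiff x).2 ?_, h1'⟩
    have : y ≤ x / s := by
      rw [le_div_iff₀ hs0, mul_comm]; exact hy
    simp only at hsum
    linarith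

/-- In terms of the ratio λ = x / y, F ≥ t says λ² - 2tλ + 1 ≥ 0, with roots s = t + √(t² - 1) and
1/s. The region is the cone x ≥ sy together with its mirror image. -/
theorem tailArea_hyperbolicDistance {t : ℝ} (ht : 1 ≤ t) :
    tailArea (fun x y => 1 / 2 * (y / x + x / y)) t =
      2 / ((t + Real.sqrt (t ^ 2 - 1)) * (t + Real.sqrt (t ^ 2 - 1) + 1)) := by
  have hsq : Real.sqrt (t ^ 2 - 1) ^ 2 = t ^ 2 - 1 := Real.sq_sqrt (by nlinarith)
  have hr0 : 0 ≤ Real.sqrt (t ^ 2 - 1) := Real.sqrt_nonneg _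
  set s := t + Real.sqrt (t ^ 2 - 1) with hs
  have hs1 : 1 ≤ s := by linarith
  have hs0 : 0 < s := by linarith
  have hst : s ^ 2 + 1 = 2 * t * s := by rw [hs]; linear_combination hsq
  -- At t = 1 both cones contain the diagonal and are not disjoint; there F ≥ 1 on the whole
  -- triangle.
  rcases ht.eq_or_lt with rfl | ht1
  · have h1 : s = 1 := by rw [hs]; norm_num
    have h2 : {z : ℝ × ℝ | 1 ≤ 1 / 2 * (z.2 / z.1 + z.1 / z.2)} ∩ fareyTriangle =
        fareyTriangle := by
      refine inter_eq_right.2 fun z hz => ?_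
      rw [Set.mem_ofPred_eq, ← not_lt, hyperbolicDistance_lt_iff hz.1.1.1 hz.1.2.1, not_lt]
      nlinarith [sq_nonneg (z.2 - z.1)]
    rw [tailArea, h2, volume_real_fareyTriangle, h1]; norm_num
  · have hs1' : 1 < s := by linarith
    have hsplit : {z : ℝ × ℝ | t ≤ 1 / 2 * (z.2 / z.1 + z.1 / z.2)} ∩ fareyTriangle =
        ({z : ℝ × ℝ | s * z.2 ≤ z.1} ∩ fareyTriangle) ∪
        Prod.swap ⁻¹' ({z : ℝ × ℝ | s * z.2 ≤ z.1} ∩ fareyTriangle) := by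
      have hiff : ∀ z ∈ fareyTriangle, t ≤ 1 / 2 * (z.2 / z.1 + z.1 / z.2) ↔
          s * z.2 ≤ z.1 ∨ s * z.1 ≤ z.2 := by
        intro z hz
        have h1 : 0 < z.1 := hz.1.1.1
        have h2 : 0 < z.2 := hz.1.2.1
        rw [← not_lt, hyperbolicDistance_lt_iff h1 h2, not_lt]
        have e : s * (z.2 ^ 2 - 2 * t * z.1 * z.2 + z.1 ^ 2) =
            (z.1 - s * z.2) * (s * z.1 - z.2) := by
          linear_combination (z.1 * z.2) * hst
        rw [← mul_nonneg_iff_of_pos_left hs0, e, mul_nonneg_iff]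
        constructor
        · rintro (⟨h, -⟩ | ⟨-, h⟩)
          · left; linarith
          · right; linarith
        · rintro (h | h)
          · left; constructor <;> nlinarith
          · right; constructor <;> nlinarith
      ext z
      have hswap : z.swap ∈ fareyTriangle ↔ z ∈ fareyTriangle := by
        simp only [mem_fareyTriangle, Prod.fst_swap, Prod.snd_swap, add_comm z.2 z.1]
        tauto
      simp only [mem_union, mem_preimage, mem_inter_iff, hswap]
      constructor
      · rintro ⟨h, hz⟩
        exact ((hiff z hz).1 h).imp (fun h => ⟨h, hz⟩) (fun h => ⟨h, hz⟩)
      · rintro (⟨h, hz⟩ | ⟨h, hz⟩)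
        · exact ⟨(hiff z hz).2 (Or.inl h), hz⟩
        · exact ⟨(hiff z hz).2 (Or.inr h), hz⟩
    have hm : MeasurableSet ({z : ℝ × ℝ | s * z.2 ≤ z.1} ∩ fareyTriangle) :=
      (measurableSet_le (by fun_prop) (by fun_prop)).inter measurableSet_fareyTriangle
    have hdisj : Disjoint ({z : ℝ × ℝ | s * z.2 ≤ z.1} ∩ fareyTriangle)
        (Prod.swap ⁻¹' ({z : ℝ × ℝ | s * z.2 ≤ z.1} ∩ fareyTriangle)) := by
      rw [Set.disjoint_left]
      rintro z ⟨h1, hz⟩ ⟨h2, -⟩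
      simp only [Set.mem_ofPred_eq, Prod.fst_swap, Prod.snd_swap] at h1 h2
      have h1' : 0 < z.1 := hz.1.1.1
      have h2' : 0 < z.2 := hz.1.2.1
      nlinarith
    have hfin : volume (Prod.swap ⁻¹' ({z : ℝ × ℝ | s * z.2 ≤ z.1} ∩ fareyTriangle)) ≠ ⊤ := by
      rw [Measure.volume_eq_prod,
        Measure.measurePreserving_swap.measure_preimage hm.nullMeasurableSet]
      exact volume_ne_top_of_subset_fareyTriangle inter_subset_right
    rw [tailArea, hsplit, measureReal_union hdisj (measurable_swap hm)
      (volume_ne_top_of_subset_fareyTriangle inter_subset_right) hfin, volume_real_preimage_swap,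
      volume_real_cone hs1]
    field_simp; ring

/-- A squeeze from 2t - 1 ≤ t + √(t² - 1) ≤ 2t. -/
theorem tailArea_hyperbolicDistance_isEquivalent :
    tailArea (fun x y => 1 / 2 * (y / x + x / y)) ~[atTop] fun t => 1 / (2 * t ^ 2) := by
  refine isEquivalent_of_tendsto_one ?_
  have hlow : Tendsto (fun t : ℝ => 1 - (2 * t + 1)⁻¹) atTop (𝓝 1) := by
    simpa using (tendsto_atTop_add_const_right atTop (1 : ℝ)
      (tendsto_id.const_mul_atTop (two_pos (α := ℝ)))).inv_tendsto_atTop.const_sub 1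
  have hup : Tendsto (fun t : ℝ => 1 + (2 * t + -1)⁻¹) atTop (𝓝 1) := by
    simpa using (tendsto_atTop_add_const_right atTop (-1 : ℝ)
      (tendsto_id.const_mul_atTop (two_pos (α := ℝ)))).inv_tendsto_atTop.const_add 1
  have hbounds : ∀ t : ℝ, 1 ≤ t → 2 * t - 1 ≤ t + Real.sqrt (t ^ 2 - 1) ∧
      t + Real.sqrt (t ^ 2 - 1) ≤ 2 * t := by
    intro t ht
    constructor
    · have : t - 1 ≤ Real.sqrt (t ^ 2 - 1) := Real.le_sqrt_of_sq_le (by nlinarith)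
      linarith
    · have : Real.sqrt (t ^ 2 - 1) ≤ t := (Real.sqrt_le_left (by linarith)).2 (by linarith)
      linarith
  refine tendsto_of_tendsto_of_tendsto_of_le_of_le' hlow hup ?_ ?_
  · filter_upwards [eventually_ge_atTop 1] with t ht
    obtain ⟨h1, h2⟩ := hbounds t ht
    simp only [Pi.div_apply]
    rw [tailArea_hyperbolicDistance ht, le_div_iff₀ (by positivity)]
    set s := t + Real.sqrt (t ^ 2 - 1)
    have hs : 0 < s := by linarith
    calc (1 - (2 * t + 1)⁻¹) * (1 / (2 * t ^ 2)) = 2 / ((2 * t) * (2 * t + 1)) := by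
          field_simp; ring
      _ ≤ _ := by gcongr
  · filter_upwards [eventually_ge_atTop 1] with t ht
    obtain ⟨h1, h2⟩ := hbounds t ht
    simp only [Pi.div_apply]
    rw [tailArea_hyperbolicDistance ht, div_le_iff₀ (by positivity)]
    set s := t + Real.sqrt (t ^ 2 - 1)
    have h3 : 0 < 2 * t - 1 := by linarith
    calc 2 / (s * (s + 1)) ≤ 2 / ((2 * t - 1) * (2 * t - 1 + 1)) := by gcongr
      _ = _ := by
          rw [show 2 * t + -1 = 2 * t - 1 by ring]
          field_simp; ring

/-! ### Euclidean slope -/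

theorem isLimitingDistribution_euclideanSlope :
    IsLimitingDistribution (fun x y => 1 / 2 * (x / y - y / x))
      (tailArea fun x y => 1 / 2 * (x / y - y / x)) := by
  refine isLimitingDistribution_tailArea volume_real_fareyTriangle fun t =>
    isEquidistributed_of_strictAntiOn
      (F := fun x y => 1 / 2 * (x / y - y / x)) ?_ ?_ (Or.inl ?_)
  · refine continuousOn_const.mul ((continuousOn_fst.div continuousOn_snd fun z hz => ?_).sub
      (continuousOn_snd.div continuousOn_fst fun z hz => ?_))
    all_goals
      have h1 : 0 < z.1 := hz.1
      have h2 : 0 < z.2 := hz.2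
      positivity
  · intro x hx y hy z hz hyz
    have hy' : 0 < y := hy
    have h1 : x / z < x / y := by gcongr
    have h2 : y / x < z / x := by gcongr
    simp only
    linarith
  · intro r x y hr _ _ _ h
    rwa [mul_div_mul_left _ _ hr.ne', mul_div_mul_left _ _ hr.ne']

/-- Only the corner at (1, 0) matters, as F is negative for x < y. If y ≤ 1/(6t), then x ≥ 1/2, x /
y ≥ 3t and y / x ≤ 1, so F ≥ (3t - 1)/2 ≥ t. Conversely F ≥ t forces x / y ≥ 2t. -/
theorem tailArea_euclideanSlope_isTheta :
    tailArea (fun x y => 1 / 2 * (x / y - y / x)) =Θ[atTop] fun t => 1 / t ^ 2 := by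
  refine isTheta_of_le_of_le (a := 1 / 36) (b := 1 / 4) (by norm_num)
    (Eventually.of_forall fun t => by positivity) ?_ ?_
  · filter_upwards [eventually_ge_atTop 1] with t ht
    refine le_trans (le_of_eq ?_) (sq_le_tailArea_of_bottomCorner (c := 1 / (6 * t)) (by positivity)
      (by rw [div_le_one (by positivity)]; linarith) fun z hz h => ?_)
    · field_simp; norm_num
    · obtain ⟨⟨⟨h1, h1'⟩, h2, -⟩, hsum⟩ := mem_fareyTriangle.1 hz
      rw [le_div_iff₀ (by positivity)] at h
      have hy : z.2 ≤ 1 / 2 := by nlinarith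
      have hx : 1 / 2 ≤ z.1 := by linarith
      have e1 : 3 * t ≤ z.1 / z.2 := by rw [le_div_iff₀ h2]; linarith
      have e2 : z.2 / z.1 ≤ 1 := by rw [div_le_one h1]; linarith
      linarith
  · filter_upwards [eventually_ge_atTop 1] with t ht
    refine le_trans (tailArea_le_of_bottomCorner (c := 1 / (2 * t)) (by positivity)
      (by rw [div_le_one (by positivity)]; linarith) fun z hz h => ?_) (le_of_eq ?_)
    · obtain ⟨⟨⟨h1, h1'⟩, h2, -⟩, hsum⟩ := mem_fareyTriangle.1 hz
      have e1 : 0 < z.2 / z.1 := by positivity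
      have e2 : 2 * t ≤ z.1 / z.2 := by linarith
      rw [le_div_iff₀ h2] at e2
      rw [le_div_iff₀ (by positivity)]
      linarith
    · field_simp; norm_num

/-! ### Euclidean area -/

/-- The length scale `w = t ^ (-1/3)`, at most `1 / 3` for `t ≥ 27`. -/
theorem exists_cube_root_scale {t : ℝ} (ht : 27 ≤ t) :
    ∃ w : ℝ, 0 < w ∧ w ≤ 1 / 3 ∧ w ^ 3 * t = 1 ∧ w ^ 2 = 1 / t ^ (2 / 3 : ℝ) := by
  have ht0 : 0 < t := by linarith
  have h3 : (t ^ (-(1 / 3) : ℝ)) ^ 3 * t = 1 := by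
    rw [← Real.rpow_natCast, ← Real.rpow_mul ht0.le]
    norm_num
    rw [Real.rpow_neg_one, inv_mul_cancel₀ ht0.ne']
  have hw : 0 < t ^ (-(1 / 3) : ℝ) := by positivity
  refine ⟨t ^ (-(1 / 3) : ℝ), hw, ?_, h3, ?_⟩
  · by_contra h
    rw [not_le] at h
    have : (1 / 3 : ℝ) ^ 3 < (t ^ (-(1 / 3) : ℝ)) ^ 3 := by gcongr
    nlinarith
  · rw [← Real.rpow_natCast, ← Real.rpow_mul ht0.le, one_div (t ^ _), ← Real.rpow_neg ht0.le]
    norm_num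

theorem isLimitingDistribution_euclideanArea :
    IsLimitingDistribution (fun x y => 1 / 4 * (1 / (x ^ 3 * y) + 1 / (x * y ^ 3)))
      (tailArea fun x y => 1 / 4 * (1 / (x ^ 3 * y) + 1 / (x * y ^ 3))) := by
  refine isLimitingDistribution_tailArea volume_real_fareyTriangle fun t =>
    isEquidistributed_of_strictAntiOn
      (F := fun x y => 1 / 4 * (1 / (x ^ 3 * y) + 1 / (x * y ^ 3))) ?_ ?_ (Or.inl ?_)
  · refine continuousOn_const.mul
      ((continuousOn_const.div ((continuousOn_fst.pow 3).mul continuousOn_snd) fun z hz => ?_).add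
        (continuousOn_const.div (continuousOn_fst.mul (continuousOn_snd.pow 3)) fun z hz => ?_))
    all_goals
      have h1 : 0 < z.1 := hz.1
      have h2 : 0 < z.2 := hz.2
      first | positivity | (simp only [Pi.mul_apply, Pi.pow_apply]; positivity)
  · intro x hx y hy z hz hyz
    have hy' : 0 < y := hy
    have h1 : 1 / (x ^ 3 * z) < 1 / (x ^ 3 * y) :=
      one_div_lt_one_div_of_lt (by positivity) (by gcongr)
    have h2 : 1 / (x * z ^ 3) < 1 / (x * y ^ 3) :=
      one_div_lt_one_div_of_lt (by positivity) (by gcongr)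
    simp only
    linarith
  · intro r x y hr hr1 hx hy h
    have h1 : r * x ≤ x := mul_le_of_le_one_left hx.le hr1
    have h2 : r * y ≤ y := mul_le_of_le_one_left hy.le hr1
    have e1 : 1 / (x ^ 3 * y) ≤ 1 / ((r * x) ^ 3 * (r * y)) :=
      one_div_le_one_div_of_le (by positivity) (by gcongr)
    have e2 : 1 / (x * y ^ 3) ≤ 1 / ((r * x) * (r * y) ^ 3) :=
      one_div_le_one_div_of_le (by positivity) (by gcongr)
    linarith

/-- Let w³t = 1. If x ≤ w/2, then 1/(4x³y) ≥ 2t, so one corner suffices from below. Conversely, when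
y ≥ 1/2, F ≤ (5/2)/x³, and 5/2 < 8 = t(2w)³ gives x ≤ 2w; the case x ≥ 1/2 is symmetric. -/
theorem tailArea_euclideanArea_isTheta :
    tailArea (fun x y => 1 / 4 * (1 / (x ^ 3 * y) + 1 / (x * y ^ 3))) =Θ[atTop]
      fun t => 1 / t ^ (2 / 3 : ℝ) := by
  refine isTheta_of_le_of_le (a := 1 / 4) (b := 8) (by norm_num) ?_ ?_ ?_
  · filter_upwards [eventually_ge_atTop 0] with t ht
    positivity
  · filter_upwards [eventually_ge_atTop 27] with t ht
    obtain ⟨w, hw0, hw1, hw3, hw2⟩ := exists_cube_root_scale ht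
    rw [← hw2]
    refine le_trans (le_of_eq ?_) (sq_le_tailArea_of_leftCorner (c := w / 2) (by positivity)
      (by linarith) fun z hz h => ?_)
    · ring
    · obtain ⟨⟨⟨h1, h1'⟩, h2, h2'⟩, hsum⟩ := mem_fareyTriangle.1 hz
      have e1 : z.1 ^ 3 * z.2 ≤ (w / 2) ^ 3 := by
        calc z.1 ^ 3 * z.2 ≤ (w / 2) ^ 3 * 1 := by gcongr
          _ = _ := mul_one _
      have e2 : 8 * t ≤ 1 / (z.1 ^ 3 * z.2) := by
        rw [le_div_iff₀ (by positivity)]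
        calc 8 * t * (z.1 ^ 3 * z.2) ≤ 8 * t * (w / 2) ^ 3 := by gcongr
          _ = w ^ 3 * t := by ring
          _ = 1 := hw3
      have e3 : 0 < 1 / (z.1 * z.2 ^ 3) := by positivity
      linarith
  · filter_upwards [eventually_ge_atTop 27] with t ht
    obtain ⟨w, hw0, hw1, hw3, hw2⟩ := exists_cube_root_scale ht
    rw [← hw2]
    have ht0 : 0 < t := by linarith
    have key : ∀ x y, 0 < x → x ≤ 1 → 1 / 2 ≤ y →
        t ≤ 1 / 4 * (1 / (x ^ 3 * y) + 1 / (x * y ^ 3)) → x ≤ 2 * w := by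
      intro x y hx hx1 hy h
      have hx3 : x ^ 3 ≤ x := pow_le_of_le_one hx.le hx1 (by norm_num)
      have hy3 : (1 / 2 : ℝ) ^ 3 ≤ y ^ 3 := by gcongr
      have b1 : 1 / (x ^ 3 * y) ≤ 2 / x ^ 3 := by
        rw [div_le_div_iff₀ (by positivity) (by positivity)]
        have : 0 < x ^ 3 := by positivity
        nlinarith
      have b2 : 1 / (x * y ^ 3) ≤ 8 / x ^ 3 := by
        rw [div_le_div_iff₀ (by positivity) (by positivity)]
        have : x * (1 / 2 : ℝ) ^ 3 ≤ x * y ^ 3 := by gcongr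
        linarith
      have b3 : t ≤ 5 / 2 / x ^ 3 := by
        have : 5 / 2 / x ^ 3 = 1 / 4 * (2 / x ^ 3 + 8 / x ^ 3) := by ring
        linarith
      rw [le_div_iff₀ (by positivity)] at b3
      by_contra hc
      rw [not_le] at hc
      have : (2 * w) ^ 3 < x ^ 3 := by gcongr
      have : t * (2 * w) ^ 3 < t * x ^ 3 := by gcongr
      linarith
    refine le_trans (tailArea_le_of_corners (c := 2 * w) (by positivity) (by linarith)
      fun z hz h => ?_) (le_of_eq (by ring))
    obtain ⟨⟨⟨h1, h1'⟩, h2, h2'⟩, hsum⟩ := mem_fareyTriangle.1 hz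
    rcases le_total (1 / 2 : ℝ) z.2 with h' | h'
    · exact Or.inl (key _ _ h1 h1' h' h)
    · refine Or.inr (key _ z.1 h2 h2' (by linarith) (h.trans (le_of_eq ?_)))
      rw [mul_comm (z.1 ^ 3), mul_comm z.1, add_comm]

/-! ### Hyperbolic angle -/

theorem isLimitingDistribution_hyperbolicAngle :
    IsLimitingDistribution (fun x y => 4 * x ^ 5 / y ^ 3 - 4 * x * y + 16 * x ^ 3 / y)
      (tailArea fun x y => 4 * x ^ 5 / y ^ 3 - 4 * x * y + 16 * x ^ 3 / y) := by
  have hhom : ∀ r x y : ℝ, 0 < r → 0 < x → 0 < y →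
      4 * (r * x) ^ 5 / (r * y) ^ 3 - 4 * (r * x) * (r * y) + 16 * (r * x) ^ 3 / (r * y) =
      r ^ 2 * (4 * x ^ 5 / y ^ 3 - 4 * x * y + 16 * x ^ 3 / y) := by
    intro r x y hr hx hy
    field_simp
  refine isLimitingDistribution_tailArea volume_real_fareyTriangle fun t =>
    isEquidistributed_of_strictAntiOn
      (F := fun x y => 4 * x ^ 5 / y ^ 3 - 4 * x * y + 16 * x ^ 3 / y) ?_ ?_ ?_
  · refine (((continuousOn_const.mul (continuousOn_fst.pow 5)).div (continuousOn_snd.pow 3)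
      fun z hz => ?_).sub ((continuousOn_const.mul continuousOn_fst).mul continuousOn_snd)).add
      ((continuousOn_const.mul (continuousOn_fst.pow 3)).div continuousOn_snd fun z hz => ?_)
    all_goals
      have h1 : 0 < z.1 := hz.1
      have h2 : 0 < z.2 := hz.2
      first | positivity | (simp only [Pi.pow_apply]; positivity)
  · intro x hx y hy z hz hyz
    have hy' : 0 < y := hy
    have h1 : 4 * x ^ 5 / z ^ 3 < 4 * x ^ 5 / y ^ 3 := by gcongr
    have h2 : 4 * x * y < 4 * x * z := by gcongr
    have h3 : 16 * x ^ 3 / z < 16 * x ^ 3 / y := by gcongr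
    simp only
    linarith
  -- F is homogeneous of degree 2, so shrinking a point moves its value towards 0: superlevel sets
  -- are star-shaped for t ≤ 0, sublevel sets for t > 0.
  · rcases le_or_gt t 0 with ht | ht
    · left
      intro r x y hr hr1 hx hy h
      rw [hhom r x y hr hx hy]
      have : r ^ 2 ≤ 1 := pow_le_one₀ hr.le hr1
      have : r ^ 2 * t ≤ r ^ 2 * (4 * x ^ 5 / y ^ 3 - 4 * x * y + 16 * x ^ 3 / y) := by gcongr
      nlinarith
    · right
      intro r x y hr hr1 hx hy h
      rw [hhom r x y hr hx hy]
      have h1 : r ^ 2 ≤ 1 := pow_le_one₀ hr.le hr1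
      have h0 : 0 < r ^ 2 := by positivity
      nlinarith

/-- F is large only as y → 0. Let w³t = 1. If y ≤ w/2, then x ≥ 1/2 and 4x⁵/y³ ≥ t, because t(w/2)³
= 1/8 = 4(1/2)⁵, while 16x³/y absorbs 4xy. Conversely F < 20/y³, and 20 < 27 = t(3w)³ gives y ≤ 3w.
-/
theorem tailArea_hyperbolicAngle_isTheta :
    tailArea (fun x y => 4 * x ^ 5 / y ^ 3 - 4 * x * y + 16 * x ^ 3 / y) =Θ[atTop]
      fun t => 1 / t ^ (2 / 3 : ℝ) := by
  refine isTheta_of_le_of_le (a := 1 / 4) (b := 9) (by norm_num) ?_ ?_ ?_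
  · filter_upwards [eventually_ge_atTop 0] with t ht
    positivity
  · filter_upwards [eventually_ge_atTop 27] with t ht
    obtain ⟨w, hw0, hw1, hw3, hw2⟩ := exists_cube_root_scale ht
    rw [← hw2]
    refine le_trans (le_of_eq ?_) (sq_le_tailArea_of_bottomCorner (c := w / 2) (by positivity)
      (by linarith) fun z hz h => ?_)
    · ring
    · obtain ⟨⟨⟨h1, h1'⟩, h2, h2'⟩, hsum⟩ := mem_fareyTriangle.1 hz
      have hx : 1 / 2 ≤ z.1 := by linarith
      have e1 : t ≤ 4 * z.1 ^ 5 / z.2 ^ 3 := by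
        rw [le_div_iff₀ (by positivity)]
        calc t * z.2 ^ 3 ≤ t * (w / 2) ^ 3 := by gcongr
          _ = (w ^ 3 * t) / 8 := by ring
          _ = 4 * (1 / 2) ^ 5 := by rw [hw3]; norm_num
          _ ≤ 4 * z.1 ^ 5 := by gcongr
      have e2 : 4 * z.1 * z.2 ≤ 16 * z.1 ^ 3 / z.2 := by
        rw [le_div_iff₀ h2]
        have hyx : z.2 ≤ z.1 := by linarith
        have : z.1 * (z.2 * z.2) ≤ z.1 * (z.1 * z.1) := by gcongr
        have : 0 < z.1 ^ 3 := by positivity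
        nlinarith
      linarith
  · filter_upwards [eventually_ge_atTop 27] with t ht
    obtain ⟨w, hw0, hw1, hw3, hw2⟩ := exists_cube_root_scale ht
    rw [← hw2]
    have ht0 : 0 < t := by linarith
    refine le_trans (tailArea_le_of_bottomCorner (c := 3 * w) (by positivity) (by linarith)
      fun z hz h => ?_) (le_of_eq (by ring))
    obtain ⟨⟨⟨h1, h1'⟩, h2, h2'⟩, hsum⟩ := mem_fareyTriangle.1 hz
    have hx5 : z.1 ^ 5 ≤ 1 := pow_le_one₀ h1.le h1'
    have hx3 : z.1 ^ 3 ≤ 1 := pow_le_one₀ h1.le h1'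
    have hy3 : z.2 ^ 3 ≤ z.2 := pow_le_of_le_one h2.le h2' (by norm_num)
    have b1 : 4 * z.1 ^ 5 / z.2 ^ 3 ≤ 4 / z.2 ^ 3 := by
      gcongr; linarith
    have b2 : 16 * z.1 ^ 3 / z.2 ≤ 16 / z.2 ^ 3 := by
      gcongr; linarith
    have b3 : 0 < 4 * z.1 * z.2 := by positivity
    have b4 : t ≤ 20 / z.2 ^ 3 := by
      have : 20 / z.2 ^ 3 = 4 / z.2 ^ 3 + 16 / z.2 ^ 3 := by ring
      linarith
    rw [le_div_iff₀ (by positivity)] at b4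
    by_contra hc
    rw [not_le] at hc
    have : (3 * w) ^ 3 < z.2 ^ 3 := by gcongr
    have : t * (3 * w) ^ 3 < t * z.2 ^ 3 := by gcongr
    linarith

end FareyFord

theorem theorem1p7 :
    -- Euclidean distance
    (∃ G : ℝ → ℝ,
      FareyFord.IsLimitingDistribution (fun x y => 1 / (2 * x ^ 2) + 1 / (2 * y ^ 2)) G ∧
      G ~[atTop] fun t => 1 / t) ∧
    -- hyperbolic distance
    (∃ G : ℝ → ℝ,
      FareyFord.IsLimitingDistribution (fun x y => 1 / 2 * (y / x + x / y)) G ∧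
      (∀ t : ℝ, 1 ≤ t →
        G t = 2 / ((t + Real.sqrt (t ^ 2 - 1)) * (t + Real.sqrt (t ^ 2 - 1) + 1))) ∧
      G ~[atTop] fun t => 1 / (2 * t ^ 2)) ∧
    -- Euclidean slope
    (∃ G : ℝ → ℝ,
      FareyFord.IsLimitingDistribution (fun x y => 1 / 2 * (x / y - y / x)) G ∧
      G =Θ[atTop] fun t => 1 / t ^ 2) ∧
    -- Euclidean area
    (∃ G : ℝ → ℝ,
      FareyFord.IsLimitingDistribution
        (fun x y => 1 / 4 * (1 / (x ^ 3 * y) + 1 / (x * y ^ 3))) G ∧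
      G =Θ[atTop] fun t => 1 / t ^ (2 / 3 : ℝ)) ∧
    -- hyperbolic angle
    (∃ G : ℝ → ℝ,
      FareyFord.IsLimitingDistribution
        (fun x y => 4 * x ^ 5 / y ^ 3 - 4 * x * y + 16 * x ^ 3 / y) G ∧
      G =Θ[atTop] fun t => 1 / t ^ (2 / 3 : ℝ)) :=
  ⟨⟨_, FareyFord.isLimitingDistribution_euclideanDistance,
      FareyFord.tailArea_euclideanDistance_isEquivalent⟩,
    ⟨_, FareyFord.isLimitingDistribution_hyperbolicDistance,
      fun _ ht => FareyFord.tailArea_hyperbolicDistance ht,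
      FareyFord.tailArea_hyperbolicDistance_isEquivalent⟩,
    ⟨_, FareyFord.isLimitingDistribution_euclideanSlope,
      FareyFord.tailArea_euclideanSlope_isTheta⟩,
    ⟨_, FareyFord.isLimitingDistribution_euclideanArea,
      FareyFord.tailArea_euclideanArea_isTheta⟩,
    ⟨_, FareyFord.isLimitingDistribution_hyperbolicAngle,
      FareyFord.tailArea_hyperbolicAngle_isTheta⟩⟩
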